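/- An entourage on a set $X$ is a reflexive symmetric relation $\varepsilon\subseteq X\times X$; put $B(x,\varepsilon)=\{y:(x,y)\in\varepsilon\}$ and $B(A,\varepsilon)=\bigcup_{a\in A}B(a,\varepsilon)$. A ballean is a set $X$ with a family $\mathcal E$ of entourages (radii) on $X$ such that $\bigcup\mathcal E=X\times X$ and for all $\varepsilon,\delta\in\mathcal E$ the composition $\varepsilon\circ\delta$ is contained in some $\eta\in\mathcal E$. Its coarse structure ${\downarrow}\mathcal E$ consists of all entourages contained in some member of $\mathcal E$; a base of ${\downarrow}\mathcal E$ is a subfamily $\mathcal B\subseteq{\downarrow}\mathcal E$ such that every member of ${\downarrow}\mathcal E$ is contained in a member of $\mathcal B$. The ballean is cellular if ${\downarrow}\mathcal E$ has a base consisting of equivalence relations. A subset $A\subseteq X$ carries the radii $\varepsilon\cap A^2$, $\varepsilon\in\mathcal E$, and $A$ is large if $X=B(A,\varepsilon)$ for some $\varepsilon\in\mathcal E$. A map between balleans is coarse if the image of every radius under it is contained in a radius. Two balleans are coarsely equivalent if there are large subsets $L,M$ of them and a bijection $L\to M$ which is coarse together with its inverse. For a ballean $X=(X,\mathcal E)$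 let - $\mathrm{cof}(X)$ be the smallest cardinality of a base of ${\downarrow}\mathcal E$; - $\mathrm{add}(X)$ be the smallest cardinality of a nonempty family $\mathcal A\subseteq{\downarrow}\mathcal E$ with $\bigcup\mathcal A\notin{\downarrow}\mathcal E\setminus\{X\times X\}$; - $\mathrm{cov}_\varepsilon(A)$ be the smallest cardinality of a set $C\subseteq X$ with $A\subseteq B(C,\varepsilon)$; - $\mathrm{cov}^\sharp(X)$ be the smallest cardinal $\kappa$ for which there is $\varepsilon\in\mathcal E$ such that $\sup_{x\in X}\mathrm{cov}_\varepsilon(B(x,\delta))<\kappa$ for every $\delta\in\mathcal E$; - $\mathrm{cov}^\flat(X)$ be the largest cardinal $\kappa$ such that for every cardinal $\lambda<\kappa$ and every $\varepsilon\in\mathcal E$ there is $\delta\in\mathcal E$ with $\min_{x\in X}\mathrm{cov}_\varepsilon(B(x,\delta))\ge\lambda$. For a (nonzero) limit ordinal $\gamma$, the Cantor macro-cube $2^{<\gamma}$ is the set of all functions $x:\gamma\to\{0,1\}$ with $\{\alpha<\gamma:x_\alpha\neq0\}$ finite, with the radii $\varepsilon_\beta=\{(x,y):x_\alpha=y_\alpha\text{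 for all }\alpha>\beta\}$, $\beta<\gamma$. The cardinal tail of $\gamma$ is $$\lceil\gamma\rceil=\min\{\alpha:\gamma\le\beta+|\alpha|\text{ for some }\beta<\gamma\}.$$ **Theorem.** For every limit ordinal $\gamma$ and every ballean $X$ the following conditions are equivalent: 1. $X$ is coarsely equivalent to $2^{<\gamma}$; 2. $X$ is cellular, $\mathrm{add}(X)=\mathrm{cof}(X)=\mathrm{cf}(\gamma)$ and $\mathrm{cov}^\flat(X)=\mathrm{cov}^\sharp(X)=\lceil\gamma\rceil$. -/

import Mathlib

universe u v

open Cardinal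

/-- A ballean structure on `X`: a set of entourages (reflexive symmetric relations), called radii,
which covers `X × X` and in which every composition of two radii is contained in a radius. -/
structure Ballean (X : Type u) where
  radii : Set (SetRel X X)
  refl : ∀ ε ∈ radii, ∀ x, (x, x) ∈ ε
  symm : ∀ ε ∈ radii, ∀ x y, (x, y) ∈ ε → (y, x) ∈ ε
  cover : ⋃₀ radii = Set.univ
  comp : ∀ ε ∈ radii, ∀ δ ∈ radii, ∃ η ∈ radii, SetRel.comp ε δ ⊆ η

/-- An entourage on `X` is a reflexive symmetric relation. -/
def IsEntourage {X : Type u} (ε : SetRel X X) : Prop :=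
  (∀ x, (x, x) ∈ ε) ∧ ∀ x y, (x, y) ∈ ε → (y, x) ∈ ε

/-- An entourage is cellular if it is transitive, i.e. an equivalence relation. -/
def IsCellularEntourage {X : Type u} (ε : SetRel X X) : Prop :=
  IsEntourage ε ∧ ∀ x y z, (x, y) ∈ ε → (y, z) ∈ ε → (x, z) ∈ ε

/-- The ball `B(x, ε) = {y : (x, y) ∈ ε}`. -/
def eball {X : Type u} (x : X) (ε : SetRel X X) : Set X := {y | (x, y) ∈ ε}

/-- The neighbourhood `B(A, ε)`, the union of the balls `B(a, ε)` with `a ∈ A`. -/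
def enbhd {X : Type u} (A : Set X) (ε : SetRel X X) : Set X := ⋃ a ∈ A, eball a ε

/-- `cov_ε(A)`: the smallest number of `ε`-balls (centred in `X`) covering `A`. -/
noncomputable def ecov {X : Type u} (ε : SetRel X X) (A : Set X) : Cardinal.{u} :=
  sInf {c | ∃ C : Set X, A ⊆ enbhd C ε ∧ #C = c}

namespace Ballean

variable {X : Type u} {Y : Type v}

/-- The coarse structure `↓E` generated by the radii: all subentourages of radii. -/
def coarse (E : Ballean X) : Set (SetRel X X) :=
  {δ | IsEntourage δ ∧ ∃ ε ∈ E.radii, δ ⊆ ε}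

/-- `B` is a base of the coarse structure `↓E`. -/
def IsBase (E : Ballean X) (B : Set (SetRel X X)) : Prop :=
  B ⊆ E.coarse ∧ ∀ δ ∈ E.coarse, ∃ ε ∈ B, δ ⊆ ε

/-- A ballean is cellular if its coarse structure has a base of equivalence relations. -/
def IsCellular (E : Ballean X) : Prop :=
  ∃ B, E.IsBase B ∧ ∀ ε ∈ B, IsCellularEntourage ε

/-- The cofinality `cof(X)`: the smallest cardinality of a base of the coarse structure. -/
noncomputable def cof (E : Ballean X) : Cardinal.{u} :=
  sInf {c | ∃ B, E.IsBase B ∧ #B = c}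

/-- The additivity `add(X)`: the smallest cardinality of a nonempty family of members of the coarse
structure whose union is not a member of the coarse structure different from `X × X`. -/
noncomputable def add (E : Ballean X) : Cardinal.{u} :=
  sInf {c | ∃ A : Set (SetRel X X), A.Nonempty ∧ A ⊆ E.coarse ∧
    ⋃₀ A ∉ E.coarse \ {Set.univ} ∧ #A = c}

/-- `cov^♯(X)`: the smallest cardinal `κ` such that for some radius `ε` and every radius `δ`
one has `sup_x cov_ε(B(x, δ)) < κ`. -/
noncomputable def covSharp (E : Ballean X) : Cardinal.{u} :=
  sInf {κ | ∃ ε ∈ E.radii, ∀ δ ∈ E.radii, ⨆ x : X, ecov ε (eball x δ) < κ}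

/-- `cov^♭(X)`: the largest cardinal `κ` such that for every cardinal `μ < κ` and every radius `ε`
there is a radius `δ` with `min_x cov_ε(B(x, δ)) ≥ μ`. -/
noncomputable def covFlat (E : Ballean X) : Cardinal.{u} :=
  sSup {κ | ∀ μ < κ, ∀ ε ∈ E.radii, ∃ δ ∈ E.radii, ∀ x : X, μ ≤ ecov ε (eball x δ)}

/-- The subballean on `A ⊆ X`, with radii the restrictions to `A` of the radii of `X`. -/
def sub (E : Ballean X) (A : Set X) : Ballean A where
  radii := {δ | ∃ ε ∈ E.radii, δ = {p : A × A | ((p.1 : X), (p.2 : X)) ∈ ε}}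
  refl := by
    rintro _ ⟨ε, hε, rfl⟩ x
    exact E.refl ε hε x
  symm := by
    rintro _ ⟨ε, hε, rfl⟩ x y h
    exact E.symm ε hε x y h
  cover := by
    refine Set.eq_univ_of_forall fun p => ?_
    have h : ((p.1 : X), (p.2 : X)) ∈ ⋃₀ E.radii := by rw [E.cover]; trivial
    obtain ⟨ε, hε, hp⟩ := h
    exact ⟨_, ⟨ε, hε, rfl⟩, hp⟩
  comp := by
    rintro _ ⟨ε, hε, rfl⟩ _ ⟨δ, hδ, rfl⟩
    obtain ⟨η, hη, h⟩ := E.comp ε hε δ hδ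
    refine ⟨_, ⟨η, hη, rfl⟩, ?_⟩
    rintro ⟨x, z⟩ ⟨y, hxy, hyz⟩
    exact h ⟨(y : X), hxy, hyz⟩

/-- A map is coarse if it sends each radius into a radius. -/
def IsCoarse (E : Ballean X) (F : Ballean Y) (f : X → Y) : Prop :=
  ∀ ε ∈ E.radii, ∃ δ ∈ F.radii, ∀ x y, (x, y) ∈ ε → (f x, f y) ∈ δ

/-- Two balleans are coarsely isomorphic if there is a bijection that is coarse in both
directions. -/
def CoarselyIsomorphic (E : Ballean X) (F : Ballean Y) : Prop :=
  ∃ f : X ≃ Y, E.IsCoarse F f ∧ F.IsCoarse E f.symm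

/-- A subset `L` is large if `X = B(L, ε)` for some radius `ε`. -/
def IsLarge (E : Ballean X) (L : Set X) : Prop :=
  ∃ ε ∈ E.radii, enbhd L ε = Set.univ

/-- Two balleans are coarsely equivalent if they contain coarsely isomorphic large subspaces. -/
def CoarselyEquivalent (E : Ballean X) (F : Ballean Y) : Prop :=
  ∃ (L : Set X) (M : Set Y), E.IsLarge L ∧ F.IsLarge M ∧ (E.sub L).CoarselyIsomorphic (F.sub M)

end Ballean

/-- The Cantor macro-cube `2^{<γ}` for a limit ordinal `γ`: the set of finitely supported functions
`γ → {0, 1}`, with the radii `ε_β = {(x, y) : x_α = y_α for all α > β}`, `β < γ`.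
Here `γ.ToType` is the well-ordered set of ordinals below `γ`. -/
noncomputable def cantorMacroCube (γ : Ordinal.{u}) (hγ : Order.IsSuccLimit γ) :
    Ballean (γ.ToType →₀ Fin 2) where
  radii := Set.range fun β : γ.ToType => {p | ∀ α, β < α → p.1 α = p.2 α}
  refl := by
    rintro _ ⟨β, rfl⟩ x α _
    rfl
  symm := by
    rintro _ ⟨β, rfl⟩ x y h α hα
    exact (h α hα).symm
  cover := by
    refine Set.eq_univ_of_forall fun p => ?_
    have : Nonempty γ.ToType :=
      Ordinal.nonempty_toType_iff.2 (Ordinal.isSuccLimit_iff.1 hγ).1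
    obtain ⟨β, hβ⟩ := (p.1.support ∪ p.2.support).exists_le
    refine ⟨_, ⟨β, rfl⟩, fun α hα => ?_⟩
    have h : α ∉ p.1.support ∪ p.2.support := fun h => absurd (hβ α h) (not_le.2 hα)
    simp only [Finset.mem_union, Finsupp.mem_support_iff, not_or, not_not] at h
    rw [h.1, h.2]
  comp := by
    rintro _ ⟨β, rfl⟩ _ ⟨β', rfl⟩
    refine ⟨_, ⟨max β β', rfl⟩, ?_⟩
    rintro ⟨x, z⟩ ⟨y, hxy, hyz⟩ α hα
    exact (hxy α ((le_max_left _ _).trans_lt hα)).trans (hyz α ((le_max_right _ _).trans_lt hα))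

/-- The cardinal tail `⌈γ⌉`: the least `α` such that `γ ≤ β + |α|` for some `β < γ`. As the
condition depends on `|α|` only, the least such ordinal is a cardinal, and the minimum is taken
over cardinals. -/
noncomputable def cardinalTail (γ : Ordinal.{u}) : Cardinal.{u} :=
  sInf {κ | ∃ β < γ, γ ≤ β + κ.ord}

/-! Everything is translated into bounded equivalence relations: covering numbers become numbers of
`s`-classes in a `t`-class (`IsTame`, `Ballean.isTame`). The core is a uniqueness statement: two
nonempty tame balleans with the same `κ ≠ 0` and the same `θ ≥ ℵ₀` are coarsely equivalent
(`IsTame.coarselyEquivalent`). The cube is one of them. The invariants are computed for every domain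
of a coarse equivalence into the cube, which settles both the cube itself and the other implication.

For `θ > ℵ₀`, infinite cardinal arithmetic allows classes to be regrouped so that, at each stage
`a`, every class of either ballean splits into exactly the same number `μ a` of earlier classes
(`exists_towers`). Such a tower gives coordinates that identify the ballean, up to bounded error,
with the finitely supported elements of a product depending only on `μ`
(`Tower.exists_coordinates`).

For `θ = ℵ₀` the counts are finite and are matched only approximately. Then `κ ≤ ℵ₀`, and the class
sizes can be made to grow so fast that rounding errors stay negligible. Classes of one side are cut
into pieces proportional to the classes of the other, with the sides alternating
(`exists_levelRelation_finset`), and an ultrafilter limit glues the finite matchings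
(`exists_levelRelation`).

In the cube, the number of classes between levels `a` and `b` lies between the cardinality of `(a,
b]` and that of the finitely supported functions on it. As `⌈γ⌉` is infinite, both bounds lead to
the same threshold. -/

namespace Ballean

variable {X : Type u} {Y : Type v}

/-! ### Coarse equivalences from relations and as maps -/

/-- A relation `R` between two balleans is controlled if it carries each radius into a radius. -/
def Controlled (E : Ballean X) (F : Ballean Y) (R : X → Y → Prop) : Prop :=
  ∀ ε ∈ E.radii, ∃ δ ∈ F.radii, ∀ x x' y y', R x y → R x' y' → (x, x') ∈ ε → (y, y') ∈ δ

theorem exists_radius (E : Ballean X) (x y : X) : ∃ ε ∈ E.radii, (x, y) ∈ ε := by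
  have h : (x, y) ∈ ⋃₀ E.radii := by rw [E.cover]; trivial
  exact h

theorem radii_nonempty [Nonempty X] (E : Ballean X) : E.radii.Nonempty := by
  inhabit X
  obtain ⟨ε, hε, -⟩ := E.exists_radius default default
  exact ⟨ε, hε⟩

theorem exists_comp₃ (E : Ballean X) {α β γ : SetRel X X} (hα : α ∈ E.radii) (hβ : β ∈ E.radii)
    (hγ : γ ∈ E.radii) : ∃ η ∈ E.radii, ∀ a b c d, (a, b) ∈ α → (b, c) ∈ β → (c, d) ∈ γ →
      (a, d) ∈ η := by
  obtain ⟨η, hη, h⟩ := E.comp α hα β hβ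
  obtain ⟨ζ, hζ, h'⟩ := E.comp η hη γ hγ
  exact ⟨ζ, hζ, fun a b c d hab hbc hcd => h' ⟨c, h ⟨b, hab, hbc⟩, hcd⟩⟩

theorem exists_radius_union (E : Ballean X) {α β : SetRel X X} (hα : α ∈ E.radii)
    (hβ : β ∈ E.radii) : ∃ η ∈ E.radii, α ⊆ η ∧ β ⊆ η := by
  obtain ⟨η, hη, h⟩ := E.comp α hα β hβ
  exact ⟨η, hη, fun ⟨x, y⟩ hxy => h ⟨y, hxy, E.refl _ hβ _⟩,
    fun ⟨x, y⟩ hxy => h ⟨x, E.refl _ hα _, hxy⟩⟩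

/-- A selection `f` of `R` and a section `g` of `f` over its range give a bijection between `{x | g
(f x) = x}` and the range. Since `x` and `g (f x)` are related to the same point, they are uniformly
close, so the first set is large; the range is large because every `y` is related to some `x`, hence
close to `f x`. -/
theorem coarselyEquivalent_of_relation [Nonempty X] {E : Ballean X} {F : Ballean Y}
    (R : X → Y → Prop) (hR : ∀ x, ∃ y, R x y) (hR' : ∀ y, ∃ x, R x y)
    (hEF : E.Controlled F R) (hFE : F.Controlled E (fun y x => R x y)) :
    E.CoarselyEquivalent F := by
  choose f hf using hR
  have : Nonempty Y := Nonempty.map f inferInstance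
  have hg : ∀ y, ∃ x, y ∈ Set.range f → f x = y := by
    intro y
    by_cases h : y ∈ Set.range f
    · obtain ⟨x, hx⟩ := h
      exact ⟨x, fun _ => hx⟩
    · exact ⟨Classical.arbitrary X, fun h' => absurd h' h⟩
  choose g hg using hg
  have hfg : ∀ x, f (g (f x)) = f x := fun x => hg _ ⟨x, rfl⟩
  obtain ⟨ε₀, hε₀⟩ := E.radii_nonempty
  obtain ⟨δ₀, hδ₀⟩ := F.radii_nonempty
  obtain ⟨ε₁, hε₁, h₁⟩ := hFE δ₀ hδ₀
  obtain ⟨δ₁, hδ₁, h₂⟩ := hEF ε₀ hε₀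
  refine ⟨{x | g (f x) = x}, Set.range f, ⟨ε₁, hε₁, ?_⟩, ⟨δ₁, hδ₁, ?_⟩, ?_⟩
  · refine Set.eq_univ_of_forall fun x => ?_
    simp only [enbhd, Set.mem_iUnion]
    refine ⟨g (f x), congrArg g (hfg x), ?_⟩
    refine h₁ (f x) (f x) _ _ ?_ (hf x) (F.refl _ hδ₀ _)
    simpa only [hfg] using hf (g (f x))
  · refine Set.eq_univ_of_forall fun y => ?_
    simp only [enbhd, Set.mem_iUnion]
    obtain ⟨x, hx⟩ := hR' y
    exact ⟨f x, ⟨x, rfl⟩, h₂ x x _ _ (hf x) hx (E.refl _ hε₀ _)⟩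
  · refine ⟨⟨fun x => ⟨f x.1, x.1, rfl⟩, fun y => ⟨g y.1, ?_⟩, ?_, ?_⟩, ?_, ?_⟩
    · exact congrArg g (hg _ y.2)
    · intro x
      exact Subtype.ext x.2
    · intro y
      exact Subtype.ext (hg _ y.2)
    · rintro _ ⟨ε, hε, rfl⟩
      obtain ⟨δ, hδ, h⟩ := hEF ε hε
      exact ⟨_, ⟨δ, hδ, rfl⟩, fun x y hxy => h _ _ _ _ (hf x.1) (hf y.1) hxy⟩
    · rintro _ ⟨δ, hδ, rfl⟩
      obtain ⟨ε, hε, h⟩ := hFE δ hδ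
      refine ⟨_, ⟨ε, hε, rfl⟩, fun x y hxy => h x.1 y.1 _ _ ?_ ?_ hxy⟩
      · have := hf (g x.1)
        rwa [hg _ x.2] at this
      · have := hf (g y.1)
        rwa [hg _ y.2] at this

/-- A map which is a coarse equivalence: bornologous, effectively proper and with large image. -/
structure IsCoarseEquivalence (E : Ballean X) (F : Ballean Y) (f : X → Y) : Prop where
  coarse : ∀ ε ∈ E.radii, ∃ δ ∈ F.radii, ∀ x x', (x, x') ∈ ε → (f x, f x') ∈ δ
  proper : ∀ δ ∈ F.radii, ∃ ε ∈ E.radii, ∀ x x', (f x, f x') ∈ δ → (x, x') ∈ ε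
  large : ∃ δ ∈ F.radii, ∀ y, ∃ x, (f x, y) ∈ δ

theorem IsCoarseEquivalence.id [Nonempty X] (E : Ballean X) :
    E.IsCoarseEquivalence E (fun x => x) where
  coarse ε hε := ⟨ε, hε, fun _ _ h => h⟩
  proper ε hε := ⟨ε, hε, fun _ _ h => h⟩
  large := by
    obtain ⟨ε, hε⟩ := E.radii_nonempty
    exact ⟨ε, hε, fun y => ⟨y, E.refl _ hε _⟩⟩

/-- Each point is moved to a nearby point `l x` of the large set `L` and then carried over by the
bijection. -/
theorem CoarselyEquivalent.exists_map {E : Ballean X} {F : Ballean Y}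
    (h : E.CoarselyEquivalent F) : ∃ f : X → Y, E.IsCoarseEquivalence F f := by
  obtain ⟨L, M, ⟨α, hα, hL⟩, ⟨β, hβ, hM⟩, e, he, he'⟩ := h
  have hL' : ∀ x, ∃ l : L, ((l : X), x) ∈ α := by
    intro x
    have : x ∈ enbhd L α := by rw [hL]; trivial
    simp only [enbhd, Set.mem_iUnion] at this
    obtain ⟨l, hl, h⟩ := this
    exact ⟨⟨l, hl⟩, h⟩
  choose l hl using hL'
  refine ⟨fun x => (e (l x) : Y), ?_, ?_, ?_⟩
  · intro ε hε
    obtain ⟨η, hη, h⟩ := E.exists_comp₃ hα hε hα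
    obtain ⟨_, ⟨δ, hδ, rfl⟩, hδ'⟩ := he _ ⟨η, hη, rfl⟩
    exact ⟨δ, hδ, fun x x' hx => hδ' _ _ (h _ _ _ _ (hl x) hx (E.symm _ hα _ _ (hl x')))⟩
  · intro δ hδ
    obtain ⟨_, ⟨ε, hε, rfl⟩, hε'⟩ := he' _ ⟨δ, hδ, rfl⟩
    obtain ⟨η, hη, h⟩ := E.exists_comp₃ hα hε hα
    refine ⟨η, hη, fun x x' hx => h _ _ _ _ (E.symm _ hα _ _ (hl x)) ?_ (hl x')⟩
    simpa using hε' (e (l x)) (e (l x')) hx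
  · obtain ⟨_, ⟨ζ, hζ, rfl⟩, hζ'⟩ := he _ ⟨α, hα, rfl⟩
    obtain ⟨η, hη, h⟩ := F.comp ζ hζ β hβ
    refine ⟨η, hη, fun y => ?_⟩
    have : y ∈ enbhd M β := by rw [hM]; trivial
    simp only [enbhd, Set.mem_iUnion] at this
    obtain ⟨m, hm, hy⟩ := this
    refine ⟨(e.symm ⟨m, hm⟩ : L), h ⟨m, ?_, hy⟩⟩
    have := hζ' (l (e.symm ⟨m, hm⟩ : L)) (e.symm ⟨m, hm⟩) (hl _)
    simpa using this

/-! ### Bounded equivalence relations, class counts and tameness -/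

/-- A setoid is bounded if it is contained in a radius. -/
def Bdd (E : Ballean X) (s : Setoid X) : Prop :=
  ∃ ε ∈ E.radii, ∀ x y, s x y → (x, y) ∈ ε

theorem Bdd.mono {E : Ballean X} {s t : Setoid X} (h : E.Bdd t) (hst : s ≤ t) : E.Bdd s := by
  obtain ⟨ε, hε, h⟩ := h
  exact ⟨ε, hε, fun x y hxy => h x y (hst hxy)⟩

theorem Bdd.mem_coarse {E : Ballean X} {s : Setoid X} (h : E.Bdd s) :
    {p : X × X | s p.1 p.2} ∈ E.coarse := by
  obtain ⟨ε, hε, h⟩ := h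
  exact ⟨⟨fun x => s.refl x, fun x y hxy => s.symm hxy⟩, ε, hε, fun p hp => h _ _ hp⟩

theorem mem_coarse_of_mem_radii {E : Ballean X} {ε : SetRel X X} (h : ε ∈ E.radii) :
    ε ∈ E.coarse :=
  ⟨⟨E.refl ε h, E.symm ε h⟩, ε, h, subset_rfl⟩

theorem isBase_coarse (E : Ballean X) : E.IsBase E.coarse :=
  ⟨subset_rfl, fun δ hδ => ⟨δ, hδ, subset_rfl⟩⟩

end Ballean

/-- The number of `s`-classes in the `t`-class of `x`. -/
noncomputable def numClasses {X : Type u} (s t : Setoid X) (x : X) : Cardinal.{u} :=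
  #(Quotient.mk s '' {y | t x y})

theorem numClasses_mono_right {X : Type u} (s : Setoid X) {t t' : Setoid X} (h : t ≤ t') (x : X) :
    numClasses s t x ≤ numClasses s t' x :=
  mk_le_mk_of_subset (Set.image_mono fun _ hy => h hy)

theorem numClasses_anti_left {X : Type u} {s s' : Setoid X} (h : s ≤ s') (t : Setoid X) (x : X) :
    numClasses s' t x ≤ numClasses s t x := by
  refine (mk_le_mk_of_subset ?_).trans
    (mk_image_le (s := Quotient.mk s '' {y | t x y}) (f := Quotient.map' id fun _ _ hxy => h hxy))
  rintro _ ⟨y, hy, rfl⟩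
  exact ⟨_, ⟨y, hy, rfl⟩, rfl⟩

theorem exists_ecov {X : Type u} {ε : SetRel X X} (hε : ∀ x, (x, x) ∈ ε) (A : Set X) :
    ∃ C : Set X, A ⊆ enbhd C ε ∧ #C = ecov ε A := by
  refine csInf_mem (s := {c | ∃ C : Set X, A ⊆ enbhd C ε ∧ #C = c}) ⟨#A, A, fun a ha => ?_, rfl⟩
  simp only [enbhd, Set.mem_iUnion]
  exact ⟨a, ha, hε a⟩

theorem ecov_le {X : Type u} {ε : SetRel X X} {A C : Set X} (h : A ⊆ enbhd C ε) :
    ecov ε A ≤ #C :=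
  csInf_le' ⟨C, h, rfl⟩

/-- An `ε`-ball lies in a single `s`-class, so each centre, inside `A` or not, accounts for at most
one class. -/
theorem numClasses_le_ecov {X : Type u} {ε : SetRel X X} (hε : ∀ x, (x, x) ∈ ε) {s t : Setoid X}
    {A : Set X} {x : X} (hs : ∀ x y, (x, y) ∈ ε → s x y) (ht : ∀ y, t x y → y ∈ A) :
    numClasses s t x ≤ ecov ε A := by
  obtain ⟨C, hC, hC'⟩ := exists_ecov hε A
  rw [← hC']
  refine (mk_le_mk_of_subset ?_).trans (mk_image_le (s := C) (f := Quotient.mk s))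
  rintro _ ⟨y, hy, rfl⟩
  have := hC (ht y hy)
  simp only [enbhd, Set.mem_iUnion] at this
  obtain ⟨c, hc, h⟩ := this
  exact ⟨c, hc, Quotient.sound (hs _ _ h)⟩

theorem ecov_le_numClasses {X : Type u} {ε : SetRel X X} {s t : Setoid X} {A : Set X} {x : X}
    (hs : ∀ x y, s x y → (x, y) ∈ ε) (ht : ∀ y ∈ A, t x y) :
    ecov ε A ≤ numClasses s t x := by
  refine (ecov_le (C := Quotient.out '' (Quotient.mk s '' {y | t x y})) ?_).trans mk_image_le
  intro y hy
  simp only [enbhd, Set.mem_iUnion]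
  exact ⟨_, ⟨_, ⟨y, ht y hy, rfl⟩, rfl⟩, hs _ _ (Quotient.mk_out y)⟩

/-- Cellular balleans with `add = cof = κ` and `cov^♭ = cov^♯ = θ`, in terms of bounded
equivalence relations. -/
structure Ballean.IsTame {X : Type u} (E : Ballean X) (κ θ : Cardinal.{u}) : Prop where
  cellular : ∀ ε ∈ E.radii, ∃ s, E.Bdd s ∧ ∀ x y, (x, y) ∈ ε → s x y
  sharp : ∃ s, E.Bdd s ∧ ∀ t, E.Bdd t → ∃ ν < θ, ∀ x, numClasses s t x ≤ ν
  flat : ∀ ν < θ, ∀ s, E.Bdd s → ∃ t, E.Bdd t ∧ ∀ x, ν ≤ numClasses s t x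
  cof : ∃ e : κ.ord.ToType → Setoid X, (∀ a, E.Bdd (e a)) ∧
    ∀ ε ∈ E.radii, ∃ a, ∀ x y, (x, y) ∈ ε → e a x y
  add : ∀ (ι : Type u) [Nonempty ι] (s : ι → Setoid X), #ι < κ → (∀ i, E.Bdd (s i)) →
    ∃ ε ∈ E.radii, ∀ i x y, s i x y → (x, y) ∈ ε

theorem Ballean.isTame {X : Type u} [Nonempty X] {E : Ballean X} {κ θ : Cardinal.{u}} (hE : E.IsCellular)
    (hadd : E.add = κ) (hcof : E.cof = κ) (hflat : E.covFlat = θ) (hsharp : E.covSharp = θ) :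
    E.IsTame κ θ := by
  have hcell : ∀ ε ∈ E.coarse, ∃ s, E.Bdd s ∧ ∀ x y, (x, y) ∈ ε → s x y := by
    obtain ⟨B, hB, hB'⟩ := hE
    intro ε hε
    obtain ⟨η, hη, hεη⟩ := hB.2 ε hε
    obtain ⟨⟨hr, hs⟩, ht⟩ := hB' η hη
    obtain ⟨-, ζ, hζ, hηζ⟩ := hB.1 hη
    exact ⟨⟨fun x y => (x, y) ∈ η, hr, hs _ _, ht _ _ _⟩, ⟨ζ, hζ, fun x y h => hηζ h⟩,
      fun x y h => hεη h⟩
  refine ⟨fun ε hε => hcell ε (mem_coarse_of_mem_radii hε), ?_, ?_, ?_, ?_⟩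
  · obtain ⟨ε, hε, h⟩ : ∃ ε ∈ E.radii, ∀ δ ∈ E.radii, ⨆ x : X, ecov ε (eball x δ) < θ := by
      rw [← hsharp]
      refine csInf_mem (s := {κ | ∃ ε ∈ E.radii, ∀ δ ∈ E.radii,
        ⨆ x : X, ecov ε (eball x δ) < κ}) ?_
      obtain ⟨ε, hε⟩ := E.radii_nonempty
      refine ⟨Order.succ #X, ε, hε, fun δ hδ => Order.lt_succ_of_le (ciSup_le' fun x => ?_)⟩
      refine (ecov_le (C := Set.univ) fun y _ => ?_).trans mk_univ.le
      simp only [enbhd, Set.mem_iUnion]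
      exact ⟨y, trivial, E.refl _ hε _⟩
    obtain ⟨s, hs, hεs⟩ := hcell ε (mem_coarse_of_mem_radii hε)
    refine ⟨s, hs, fun t ht => ?_⟩
    obtain ⟨δ, hδ, ht⟩ := ht
    refine ⟨_, h δ hδ, fun x => le_trans ?_ (le_ciSup (bddAbove_of_small) x)⟩
    exact numClasses_le_ecov (E.refl _ hε) hεs (fun y h => ht x y h)
  · intro ν hν s hs
    obtain ⟨ε, hε, hs⟩ := hs
    rw [← hflat] at hν
    -- The cardinal `0` satisfies the defining condition of `covFlat` vacuously, so the supremum is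
    -- over a nonempty set.
    obtain ⟨μ, hμ, hνμ⟩ := exists_lt_of_lt_csSup ⟨0, fun μ hμ => absurd hμ not_lt_zero⟩ hν
    obtain ⟨δ, hδ, h⟩ := hμ ν hνμ ε hε
    obtain ⟨t, ht, hδt⟩ := hcell δ (mem_coarse_of_mem_radii hδ)
    exact ⟨t, ht, fun x => (h x).trans (ecov_le_numClasses hs fun y hy => hδt _ _ hy)⟩
  · obtain ⟨B, hB, hBc⟩ := csInf_mem (s := {c | ∃ B, E.IsBase B ∧ #B = c})
      ⟨_, E.coarse, E.isBase_coarse, rfl⟩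
    have : #κ.ord.ToType = #B := by
      rw [mk_ord_toType, hBc]
      exact hcof.symm
    obtain ⟨e⟩ := Cardinal.eq.1 this
    choose s hs hs' using hcell
    refine ⟨fun a => s (e a) (hB.1 (e a).2), fun a => hs _ _, fun ε hε => ?_⟩
    obtain ⟨η, hη, hεη⟩ := hB.2 ε (mem_coarse_of_mem_radii hε)
    refine ⟨e.symm ⟨η, hη⟩, fun x y h => hs' _ _ x y ?_⟩
    rw [Equiv.apply_symm_apply]
    exact hεη h
  · intro ι _ s hι hs
    by_contra hcon
    push Not at hcon
    have hA : Set.range (fun i => {p : X × X | s i p.1 p.2}) ⊆ E.coarse := by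
      rintro _ ⟨i, rfl⟩
      exact (hs i).mem_coarse
    have : E.add ≤ #(Set.range (fun i => {p : X × X | s i p.1 p.2})) := by
      refine csInf_le' ⟨_, Set.range_nonempty _, hA, fun h => ?_, rfl⟩
      obtain ⟨⟨-, ε, hε, h⟩, -⟩ := h
      obtain ⟨i, x, y, hxy, hn⟩ := hcon ε hε
      exact hn (h ⟨_, ⟨i, rfl⟩, hxy⟩)
    exact absurd ((this.trans mk_range_le).trans_lt hι) (by simp [hadd])

/-- The empty set carries a single relation, so there the whole coarse structure is a base with at
most one member. -/
theorem Ballean.nonempty_of_one_lt_cof {X : Type u} {E : Ballean X} (h : 1 < E.cof) :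
    Nonempty X := by
  by_contra hX
  rw [not_nonempty_iff] at hX
  have hle : E.cof ≤ #E.coarse := csInf_le' ⟨E.coarse, E.isBase_coarse, rfl⟩
  refine absurd h (not_lt.2 (hle.trans ?_))
  have : Subsingleton (SetRel X X) := inferInstanceAs (Subsingleton (Set (X × X)))
  exact mk_le_one_iff_set_subsingleton.2 (Set.subsingleton_of_subsingleton)

/-! ### Towers with exact class counts and their coordinates -/

namespace Ballean

/-- A well-ordered tower of bounded equivalence relations `u a ≤ v a`, in which every `v a`-class
consists of exactly `μ a` many `u a`-classes. -/
structure Tower {X : Type u} (E : Ballean X) {I : Type u} [LinearOrder I] (u v : I → Setoid X)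
    (μ : I → Cardinal.{u}) : Prop where
  le : ∀ a, u a ≤ v a
  lt : ∀ a b, a < b → v a ≤ u b
  bdd : ∀ a, E.Bdd (v a)
  cofinal : ∀ ε ∈ E.radii, ∃ a, ∀ x y, (x, y) ∈ ε → v a x y
  cont : ∀ a b x y, u b x y → u a x y ∨ ∃ d < b, v d x y
  card : ∀ a x, numClasses (u a) (v a) x = μ a

end Ballean

/-- Coordinates enumerating the `u`-classes in each `v`-class, with prescribed zeros. -/
theorem exists_coordinate {X J : Type u} {u v : Setoid X} (huv : u ≤ v)
    (hcard : ∀ x, numClasses u v x = #J) (j₀ : J) (r : X → X) (hr : ∀ x, v x (r x))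
    (hr' : ∀ x y, v x y → r x = r y) :
    ∃ c : X → J, (∀ x y, u x y → c x = c y) ∧ (∀ x y, v x y → c x = c y → u x y) ∧
      (∀ x j, ∃ y, v x y ∧ c y = j) ∧ ∀ x, c (r x) = j₀ := by
  classical
  have key : ∀ q : Quotient v, ∃ f : Quotient u → J,
      Set.BijOn f (Quotient.mk u '' {y | v q.out y}) Set.univ ∧ f (Quotient.mk u (r q.out)) = j₀ := by
    intro q
    obtain ⟨e⟩ := Cardinal.eq.1 (hcard q.out)
    let e' := e.trans (Equiv.swap (e ⟨Quotient.mk u (r q.out), r q.out, hr _, rfl⟩) j₀)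
    refine ⟨fun p => if h : p ∈ Quotient.mk u '' {y | v q.out y} then e' ⟨p, h⟩ else j₀,
      ⟨fun _ _ => trivial, ?_, ?_⟩, ?_⟩
    · intro p hp p' hp' h
      simp only [dif_pos hp, dif_pos hp'] at h
      exact congrArg Subtype.val (e'.injective h)
    · intro j _
      refine ⟨(e'.symm j).1, (e'.symm j).2, ?_⟩
      simp only [dif_pos (e'.symm j).2, Subtype.coe_eta, Equiv.apply_symm_apply]
    · have h : Quotient.mk u (r q.out) ∈ Quotient.mk u '' {y | v q.out y} :=
        ⟨r q.out, hr _, rfl⟩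
      simp only [dif_pos h]
      simp [e']
  choose f hf hf' using key
  have hmem : ∀ x y, v x y →
      Quotient.mk u y ∈ Quotient.mk u '' {z | v (Quotient.mk v x).out z} := fun x y h =>
    ⟨y, v.trans (Quotient.mk_out x) h, rfl⟩
  refine ⟨fun x => f (Quotient.mk v x) (Quotient.mk u x), ?_, ?_, ?_, ?_⟩
  · intro x y h
    simp only [Quotient.sound (s := u) h, Quotient.sound (s := v) (huv h)]
  · intro x y h hc
    simp only [← Quotient.sound (s := v) h] at hc
    exact Quotient.exact ((hf _).2.1 (hmem x x (v.refl x)) (hmem x y h) hc)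
  · intro x j
    obtain ⟨p, ⟨y, hy, rfl⟩, h⟩ := (hf (Quotient.mk v x)).2.2 (Set.mem_univ j)
    have hxy : v x y := v.trans (v.symm (Quotient.mk_out x)) hy
    refine ⟨y, hxy, ?_⟩
    simp only [← Quotient.sound (s := v) hxy, h]
  · intro x
    have h := hf' (Quotient.mk v x)
    rw [hr' _ x (Quotient.mk_out x)] at h
    simpa only [← Quotient.sound (s := v) (hr x)] using h

namespace Ballean.Tower

variable {X : Type u} {E : Ballean X} {I : Type u} [LinearOrder I]
  {u v : I → Setoid X} {μ : I → Cardinal.{u}}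

theorem mono (h : E.Tower u v μ) {a b : I} (hab : a ≤ b) : v a ≤ v b := by
  obtain rfl | hab := hab.eq_or_lt
  · exact le_rfl
  · exact (h.lt a b hab).trans (h.le b)

theorem exists_rel (h : E.Tower u v μ) (x y : X) : ∃ a, v a x y := by
  obtain ⟨ε, hε, hxy⟩ := E.exists_radius x y
  obtain ⟨a, ha⟩ := h.cofinal ε hε
  exact ⟨a, ha x y hxy⟩

variable [WellFoundedLT I]

/-- Coordinates on a ballean with a tower, identifying it with a sum of pointed sets. -/
theorem exists_coordinates [Nonempty X] (h : E.Tower u v μ) {J : I → Type u}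
    (hJ : ∀ a, #(J a) = μ a) (j₀ : ∀ a, J a) :
    ∃ c : X → ∀ a, J a, (∀ a x y, v a x y ↔ ∀ b, a < b → c x b = c y b) ∧
      (∀ x, {a | c x a ≠ j₀ a}.Finite) ∧
      ∀ w : ∀ a, J a, {a | w a ≠ j₀ a}.Finite → ∃ x, c x = w := by
  classical
  let _ : LinearOrder X := linearOrderOfSTO WellOrderingRel
  have : WellFoundedLT X := ⟨(WellOrderingRel.isWellOrder (α := X)).wf⟩
  have hne : ∀ a x, {y | v a x y}.Nonempty := fun a x => ⟨x, (v a).refl x⟩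
  -- The least point of each `v a`-class, in a well-order of `X`, is the one that receives the
  -- coordinate `j₀ a`.
  let r : I → X → X := fun a x => wellFounded_lt.min {y | v a x y} (hne a x)
  have hr : ∀ a x, v a x (r a x) := fun a x => wellFounded_lt.min_mem _ (hne a x)
  have hrle : ∀ a x y, v a x y → r a x ≤ y := fun a x y hxy =>
    not_lt.1 (wellFounded_lt.not_lt_min {y | v a x y} hxy)
  have hr' : ∀ a x y, v a x y → r a x = r a y := fun a x y hxy =>
    le_antisymm (hrle _ _ _ ((v a).trans hxy (hr _ _)))
      (hrle _ _ _ ((v a).trans ((v a).symm hxy) (hr _ _)))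
  have hex := fun a => exists_coordinate (h.le a) (fun x => (h.card a x).trans (hJ a).symm) (j₀ a)
    (r a) (hr a) (hr' a)
  choose c hc₁ hc₂ hc₃ hc₄ using hex
  refine ⟨fun x a => c a x, ?_, ?_, ?_⟩
  · intro a x y
    refine ⟨fun hxy b hab => hc₁ b x y (h.lt a b hab hxy), fun hxy => ?_⟩
    by_contra hcon
    -- The least level `b` relating `x` and `y` cannot exceed `a`: equal `b`-th coordinates give `u
    -- b x y`, and `cont` turns this into `u a x y` or a relation at a level below `b`.
    obtain ⟨b, hb, hmin⟩ := wellFounded_lt.has_min {b | v b x y} (h.exists_rel x y)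
    have hab : a < b := by
      by_contra hba
      exact hcon (h.mono (not_lt.1 hba) hb)
    obtain h' | ⟨d, hd, h'⟩ := h.cont a b x y (hc₂ b x y hb (hxy b hab))
    · exact hcon (h.le a h')
    · exact hmin d h' hd
  · intro x
    -- Along the support of `x` the least points strictly decrease: if `r b x = r a x`, then `x` is
    -- `u b`-related to `r b x`, whose `b`-th coordinate is `j₀ b`. An infinite support would thus
    -- give an infinite descent in the well-order of `X`.
    have hanti : ∀ a b, c a x ≠ j₀ a → c b x ≠ j₀ b → a < b → r b x < r a x := by
      intro a b _ hb hab
      refine lt_of_le_of_ne (hrle b x _ (h.mono hab.le (hr a x))) fun heq => hb ?_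
      rw [← hc₄ b x]
      refine hc₁ b _ _ ?_
      rw [heq]
      exact h.lt a b hab (hr a x)
    let S := {a | c a x ≠ j₀ a}
    have : WellFoundedGT S := by
      let g : S → X := fun a => r a.1 x
      refine ⟨Subrelation.wf (r := fun a b => g a < g b) ?_ (InvImage.wf g wellFounded_lt)⟩
      intro a b hab
      exact hanti b.1 a.1 b.2 a.2 hab
    have := Finite.of_wellFoundedLT_wellFoundedGT S
    exact Set.toFinite S
  · intro w hw
    suffices H : ∀ s : Finset I, ∀ w : ∀ a, J a, (∀ a, w a ≠ j₀ a → a ∈ s) → ∃ x, ∀ a, c a x = w a by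
      obtain ⟨x, hx⟩ := H hw.toFinset w fun a ha => by simpa using ha
      exact ⟨x, funext hx⟩
    intro s
    induction s using Finset.induction_on_min with
    | empty =>
      intro w hw
      let m : X := wellFounded_lt.min Set.univ Set.univ_nonempty
      have hm : ∀ a, r a m = m := fun a => le_antisymm (hrle a m m ((v a).refl m))
        (not_lt.1 (wellFounded_lt.not_lt_min _ (Set.mem_univ _)))
      refine ⟨m, fun a => ?_⟩
      have := hc₄ a m
      rw [hm] at this
      rw [this]
      by_contra hcon
      simpa using hw a (Ne.symm hcon)
    | insert a s hs ih =>
      intro w hw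
      -- Coordinates are realised from the top down. Once those above `a` are right, a move inside
      -- the `v a`-class sets the `a`-th one, and passing to the least point of the `u a`-class
      -- resets all lower ones to `j₀`.
      obtain ⟨x, hx⟩ := ih (Function.update w a (j₀ a)) fun b hb => by
        by_cases hba : b = a
        · subst hba
          simp at hb
        · rw [Function.update_of_ne hba] at hb
          exact (Finset.mem_insert.1 (hw b hb)).resolve_left hba
      obtain ⟨y, hxy, hy⟩ := hc₃ a x (w a)
      have hne' : {z | u a y z}.Nonempty := ⟨y, (u a).refl y⟩
      let z := wellFounded_lt.min _ hne'
      have hz : u a y z := wellFounded_lt.min_mem _ hne'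
      refine ⟨z, fun b => ?_⟩
      obtain hba | rfl | hab := lt_trichotomy b a
      · have hrz : r b z = z := by
          refine le_antisymm (hrle b z z ((v b).refl z)) (not_lt.1 ?_)
          exact wellFounded_lt.not_lt_min {z | u a y z} ((u a).trans hz (h.lt b a hba (hr b z)))
        have := hc₄ b z
        rw [hrz] at this
        rw [this]
        by_contra hcon
        obtain h' | h' := Finset.mem_insert.1 (hw b (Ne.symm hcon))
        · exact hba.ne h'
        · exact (hs b h').not_gt hba
      · rw [← hc₁ b y z hz, hy]
      · have hxz : v a x z := (v a).trans hxy (h.le a hz)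
        rw [← hc₁ b x z (h.lt a b hab hxz), hx, Function.update_of_ne hab.ne']

/-- Points are related when their coordinates agree. This need not be a bijection, since points that
are `u a`-related for every `a` share all coordinates. -/
theorem exists_relation {Y : Type u} {F : Ballean Y} {u' v' : I → Setoid Y} [Nonempty X]
    [Nonempty Y] (h : E.Tower u v μ) (h' : F.Tower u' v' μ) :
    ∃ R : X → Y → Prop, (∀ x, ∃ y, R x y) ∧ (∀ y, ∃ x, R x y) ∧
      E.Controlled F R ∧ F.Controlled E (fun y x => R x y) := by
  have hJ : ∀ a, Nonempty (μ a).out := by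
    intro a
    rw [← mk_ne_zero_iff, mk_out, ← h.card a (Classical.arbitrary X), numClasses, mk_ne_zero_iff]
    exact ⟨⟨_, _, (v a).refl _, rfl⟩⟩
  let j₀ := fun a => Classical.choice (hJ a)
  obtain ⟨c, hc, hf, hs⟩ := h.exists_coordinates (fun a => mk_out (μ a)) j₀
  obtain ⟨c', hc', hf', hs'⟩ := h'.exists_coordinates (fun a => mk_out (μ a)) j₀
  refine ⟨fun x y => c x = c' y, fun x => ?_, fun y => hs _ (hf' y), ?_, ?_⟩
  · obtain ⟨y, hy⟩ := hs' _ (hf x)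
    exact ⟨y, hy.symm⟩
  · intro ε hε
    obtain ⟨a, ha⟩ := h.cofinal ε hε
    obtain ⟨δ, hδ, hv⟩ := h'.bdd a
    refine ⟨δ, hδ, fun x x' y y' hxy hxy' hx => hv _ _ ((hc' a y y').2 ?_)⟩
    rw [← hxy, ← hxy']
    exact (hc a x x').1 (ha _ _ hx)
  · intro δ hδ
    obtain ⟨a, ha⟩ := h'.cofinal δ hδ
    obtain ⟨ε, hε, hv⟩ := h.bdd a
    refine ⟨ε, hε, fun y y' x x' hxy hxy' hy => hv _ _ ((hc a x x').2 ?_)⟩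
    rw [hxy, hxy']
    exact (hc' a y y').1 (ha _ _ hy)

end Ballean.Tower

/-! ### Construction of matching towers for uncountable `θ` -/

/-- If all fibres of `f` have at least `#J` elements, `P` can be partitioned into sets of size `#J`,
each contained in a fibre. -/
theorem exists_equiv_prod_fiber {P Q J : Type u} [Infinite J] (f : P → Q)
    (h : ∀ p, #J ≤ #{p' // f p' = f p}) : ∃ e : P ≃ P × J, ∀ p, f (e p).1 = f p := by
  have key : ∀ p, Nonempty ({p' // f p' = f p} ≃ {p' // f p' = f p} × J) := by
    intro p
    rw [← Cardinal.eq, mk_prod, lift_id, lift_id]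
    exact (mul_eq_left ((aleph0_le_mk J).trans (h p)) (h p) (mk_ne_zero J)).symm
  have key' : ∀ q, Nonempty ({p' // f p' = q} ≃ {p' // f p' = q} × J) := by
    intro q
    by_cases hq : ∃ p, f p = q
    · obtain ⟨p, rfl⟩ := hq
      exact key p
    · have : IsEmpty {p' // f p' = q} := ⟨fun p => hq ⟨p.1, p.2⟩⟩
      exact ⟨Equiv.equivOfIsEmpty _ _⟩
  let e := fun q => Classical.choice (key' q)
  let e₁ : P ≃ (Σ q, {p // f p = q}) := (Equiv.sigmaFiberEquiv f).symm
  let e₂ : (Σ q, {p // f p = q}) ≃ (Σ q, {p // f p = q} × J) := Equiv.sigmaCongrRight e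
  let e₃ : (Σ q, {p // f p = q} × J) ≃ (Σ q, {p // f p = q}) × J :=
    (Equiv.sigmaProdDistrib _ _).symm
  refine ⟨e₁.trans (e₂.trans (e₃.trans (Equiv.prodCongr e₁.symm (Equiv.refl J)))), fun p => ?_⟩
  exact (e (f p) ⟨p, rfl⟩).1.2

namespace Ballean

variable {X Y : Type u} {E : Ballean X} {F : Ballean Y} {κ θ : Cardinal.{u}}

theorem IsTame.exists_ge (hE : E.IsTame κ θ) {s t : Setoid X} (hs : E.Bdd s) (ht : E.Bdd t) :
    ∃ w, E.Bdd w ∧ s ≤ w ∧ t ≤ w := by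
  obtain ⟨ε, hε, hs⟩ := hs
  obtain ⟨δ, hδ, ht⟩ := ht
  obtain ⟨η, hη, h₁, h₂⟩ := E.exists_radius_union hε hδ
  obtain ⟨w, hw, h⟩ := hE.cellular η hη
  exact ⟨w, hw, fun {x y} hxy => h _ _ (h₁ (hs x y hxy)), fun {x y} hxy => h _ _ (h₂ (ht x y hxy))⟩

/-- Flatness gives a bounded `z` with at least `μ` many `w`-classes in each `z`-class. These are
grouped into packs of exactly `μ`, and the packs are the `v`-classes. A pack contains at least `μ`
and at most `μ * μ = μ` many `u`-classes. -/
theorem IsTame.exists_numClasses_eq (hE : E.IsTame κ θ) {u w : Setoid X} (hw : E.Bdd w)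
    (huw : u ≤ w) {μ : Cardinal.{u}} (hμ : μ < θ) (hμ' : ℵ₀ ≤ μ)
    (hle : ∀ x, numClasses u w x ≤ μ) :
    ∃ v, E.Bdd v ∧ w ≤ v ∧ ∀ x, numClasses u v x = μ := by
  obtain ⟨z₀, hz₀, hcard⟩ := hE.flat μ hμ w hw
  obtain ⟨z, hz, hwz, hz₀z⟩ := hE.exists_ge hw hz₀
  obtain ⟨J, rfl⟩ : ∃ J : Type u, #J = μ := ⟨μ.out, mk_out μ⟩
  have : Infinite J := infinite_iff.2 hμ'
  let f : Quotient w → Quotient z := Quotient.map' id fun x y h => hwz h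
  obtain ⟨e, he⟩ := exists_equiv_prod_fiber (J := J) f (by
    intro p
    induction p using Quotient.inductionOn with | h x => ?_
    refine (hcard x).trans (mk_le_mk_of_subset (s := Quotient.mk w '' {y | z₀ x y})
      (t := {p' | f p' = f (Quotient.mk w x)}) ?_)
    rintro _ ⟨y, hy, rfl⟩
    exact Quotient.sound (s := z) (z.symm (hz₀z hy)))
  let v : Setoid X := Setoid.ker fun x => (e (Quotient.mk w x)).1
  have hv : ∀ x y, v x y ↔ (e (Quotient.mk w x)).1 = (e (Quotient.mk w y)).1 := fun x y => Iff.rfl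
  have hwv : w ≤ v := fun {x y} h => by
    rw [hv, Quotient.sound (s := w) h]
  have hvz : v ≤ z := fun {x y} h => by
    have h' := congrArg f h
    simp only [he] at h'
    exact Quotient.exact (s := z) h'
  refine ⟨v, hz.mono hvz, hwv, fun x => le_antisymm ?_ ?_⟩
  · choose y hy using fun j => Quotient.exists_rep (e.symm ((e (Quotient.mk w x)).1, j))
    have hsub : Quotient.mk u '' {y | v x y} ⊆ ⋃ j : J, Quotient.mk u '' {y' | w (y j) y'} := by
      rintro _ ⟨y', hy', rfl⟩
      refine Set.mem_iUnion.2 ⟨(e (Quotient.mk w y')).2, y', ?_, rfl⟩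
      refine Quotient.exact (s := w) ((hy _).trans ?_)
      rw [Equiv.symm_apply_eq]
      exact Prod.ext hy' rfl
    refine (mk_le_mk_of_subset hsub).trans ((mk_iUnion_le _).trans ?_)
    calc #J * ⨆ j, #(Quotient.mk u '' {y' | w (y j) y'}) ≤ #J * #J := by
          gcongr
          exact ciSup_le' fun j => hle (y j)
      _ = #J := mul_eq_self hμ'
  · refine le_trans ?_ (numClasses_anti_left huw v x)
    refine mk_le_of_injective (f := fun j : J =>
      (⟨e.symm ((e (Quotient.mk w x)).1, j), ?_⟩ : Quotient.mk w '' {y | v x y})) ?_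
    · obtain ⟨y, hy⟩ := Quotient.exists_rep (e.symm ((e (Quotient.mk w x)).1, j))
      refine ⟨y, ?_, hy⟩
      have hy' : Quotient.mk w y = e.symm ((e (Quotient.mk w x)).1, j) := hy
      change (e (Quotient.mk w x)).1 = (e (Quotient.mk w y)).1
      rw [hy', Equiv.apply_symm_apply]
    · intro j j' h
      simpa using congrArg Subtype.val h

/-- Both towers come from one transfinite recursion, so that the counts agree stage by stage. Stage
`a` absorbs `e a` and `e' a`, which yields cofinality. -/
theorem exists_towers (hE : E.IsTame κ θ) (hF : F.IsTame κ θ) (hθ : ℵ₀ < θ) :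
    ∃ (u v : κ.ord.ToType → Setoid X) (u' v' : κ.ord.ToType → Setoid Y)
      (μ : κ.ord.ToType → Cardinal.{u}), E.Tower u v μ ∧ F.Tower u' v' μ := by
  obtain ⟨s, hs, hsharp⟩ := hE.sharp
  obtain ⟨s', hs', hsharp'⟩ := hF.sharp
  obtain ⟨e, he, hcof⟩ := hE.cof
  obtain ⟨e', he', hcof'⟩ := hF.cof
  -- The boundedness assumptions are placed after the existential quantifiers: the choice functions
  -- are then total, and the recursion can be defined before boundedness is known.
  have step : ∀ a u u', ∃ v v' μ, E.Bdd u → F.Bdd u' → s ≤ u → s' ≤ u' →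
      (E.Bdd v ∧ u ≤ v ∧ e a ≤ v ∧ ∀ x, numClasses u v x = μ) ∧
      (F.Bdd v' ∧ u' ≤ v' ∧ e' a ≤ v' ∧ ∀ y, numClasses u' v' y = μ) := by
    intro a u u'
    by_cases h : E.Bdd u ∧ F.Bdd u' ∧ s ≤ u ∧ s' ≤ u'
    · obtain ⟨hu, hu', hsu, hsu'⟩ := h
      obtain ⟨w, hw, huw, hew⟩ := hE.exists_ge hu (he a)
      obtain ⟨w', hw', huw', hew'⟩ := hF.exists_ge hu' (he' a)
      obtain ⟨ν, hν, hle⟩ := hsharp w hw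
      obtain ⟨ν', hν', hle'⟩ := hsharp' w' hw'
      -- The common count is `max (max ν ν') ℵ₀`: it dominates the counts on both sides, is
      -- infinite, and is below `θ` because `ℵ₀ < θ`.
      obtain ⟨v, hv, hwv, hcard⟩ := hE.exists_numClasses_eq hw huw
        (max_lt (max_lt hν hν') hθ) (le_max_right _ _) fun x =>
          (numClasses_anti_left hsu w x).trans <| (hle x).trans <|
            (le_max_left ν ν').trans (le_max_left _ ℵ₀)
      obtain ⟨v', hv', hwv', hcard'⟩ := hF.exists_numClasses_eq hw' huw'
        (max_lt (max_lt hν hν') hθ) (le_max_right _ _) fun x =>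
          (numClasses_anti_left hsu' w' x).trans <| (hle' x).trans <|
            (le_max_right ν ν').trans (le_max_left _ ℵ₀)
      exact ⟨v, v', _, fun _ _ _ _ => ⟨⟨hv, huw.trans hwv, hew.trans hwv, hcard⟩,
        ⟨hv', huw'.trans hwv', hew'.trans hwv', hcard'⟩⟩⟩
    · exact ⟨u, u', 0, fun h₁ h₂ h₃ h₄ => absurd ⟨h₁, h₂, h₃, h₄⟩ h⟩
  choose V V' M hV using step
  let W : κ.ord.ToType → Setoid X × Setoid Y := WellFoundedLT.fix fun a W =>
    (V a (s ⊔ ⨆ b : Set.Iio a, (W b.1 b.2).1) (s' ⊔ ⨆ b : Set.Iio a, (W b.1 b.2).2),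
      V' a (s ⊔ ⨆ b : Set.Iio a, (W b.1 b.2).1) (s' ⊔ ⨆ b : Set.Iio a, (W b.1 b.2).2))
  let u : κ.ord.ToType → Setoid X := fun a => s ⊔ ⨆ b : Set.Iio a, (W b.1).1
  let u' : κ.ord.ToType → Setoid Y := fun a => s' ⊔ ⨆ b : Set.Iio a, (W b.1).2
  have hW : ∀ a, W a = (V a (u a) (u' a), V' a (u a) (u' a)) := fun a =>
    WellFoundedLT.fix_eq _ a
  have hlt : ∀ a b, a < b → (W a).1 ≤ u b := fun a b hab =>
    le_sup_of_le_right (le_iSup (fun c : Set.Iio b => (W c.1).1) ⟨a, hab⟩)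
  have hlt' : ∀ a b, a < b → (W a).2 ≤ u' b := fun a b hab =>
    le_sup_of_le_right (le_iSup (fun c : Set.Iio b => (W c.1).2) ⟨a, hab⟩)
  have hsu : ∀ a, s ≤ u a := fun a => le_sup_left
  have hsu' : ∀ a, s' ≤ u' a := fun a => le_sup_left
  -- The supremum of a chain of equivalence relations is its union, and it stays bounded by
  -- additivity because an initial segment of `κ.ord` has fewer than `κ` elements.
  have union : ∀ {Z : Type u} {G : Ballean Z} (hG : G.IsTame κ θ) (σ : Setoid Z) (hσ : G.Bdd σ)
      (w : κ.ord.ToType → Setoid Z) (a : κ.ord.ToType)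
      (hmono : ∀ b c, b < c → c < a → w b ≤ w c) (hσw : ∀ b < a, σ ≤ w b)
      (hw : ∀ b < a, G.Bdd (w b)),
      (∀ x y, (σ ⊔ ⨆ b : Set.Iio a, w b.1) x y → σ x y ∨ ∃ b < a, w b x y) ∧
        G.Bdd (σ ⊔ ⨆ b : Set.Iio a, w b.1) := by
    intro Z G hG σ hσ w a hmono hσw hw
    obtain ha | ha := isEmpty_or_nonempty (Set.Iio a)
    · rw [iSup_of_empty, sup_bot_eq]
      exact ⟨fun x y h => Or.inl h, hσ⟩
    · have hun : ∀ x y, (σ ⊔ ⨆ b : Set.Iio a, w b.1) x y → ∃ b < a, w b x y := by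
        let T : Setoid Z := ⟨fun x y => ∃ b < a, w b x y, ?_, ?_, ?_⟩
        · have hT : σ ⊔ ⨆ b : Set.Iio a, w b.1 ≤ T := by
            refine sup_le ?_ (iSup_le fun b {x y} h => ⟨b.1, b.2, h⟩)
            intro x y h
            obtain ⟨b, hb⟩ := ha
            exact ⟨b, hb, hσw b hb h⟩
          exact fun x y h => hT h
        · intro x
          obtain ⟨b, hb⟩ := ha
          exact ⟨b, hb, (w b).refl x⟩
        · rintro x y ⟨b, hb, h⟩
          exact ⟨b, hb, (w b).symm h⟩
        · rintro x y z ⟨b, hb, h⟩ ⟨c, hc, h'⟩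
          obtain hbc | rfl | hbc := lt_trichotomy b c
          · exact ⟨c, hc, (w c).trans (hmono b c hbc hc h) h'⟩
          · exact ⟨b, hb, (w b).trans h h'⟩
          · exact ⟨b, hb, (w b).trans h (hmono c b hbc hb h')⟩
      refine ⟨fun x y h => Or.inr (hun x y h), ?_⟩
      obtain ⟨ε, hε, h⟩ := hG.add (Set.Iio a) (fun b => w b.1) ((mk_Iio_lt a (by simp)).trans_eq (mk_ord_toType κ))
        (fun b => hw b.1 b.2)
      refine ⟨ε, hε, fun x y hxy => ?_⟩
      obtain ⟨b, hb, hb'⟩ := hun x y hxy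
      exact h ⟨b, hb⟩ x y hb'
  have main : ∀ a, E.Bdd (u a) ∧ F.Bdd (u' a) ∧
      (∀ x y, u a x y → s x y ∨ ∃ b < a, (W b).1 x y) ∧
      (∀ x y, u' a x y → s' x y ∨ ∃ b < a, (W b).2 x y) := by
    intro a
    induction a using WellFoundedLT.induction with | ind a ih => ?_
    have hb : ∀ b < a, _ := fun b hb =>
      hV b (u b) (u' b) (ih b hb).1 (ih b hb).2.1 (hsu b) (hsu' b)
    have h₁ := union hE s hs (fun b => (W b).1) a
      (fun b c hbc hca => (hlt b c hbc).trans (by rw [hW]; exact (hb c hca).1.2.1))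
      (fun b hba => (hsu b).trans (by rw [hW]; exact (hb b hba).1.2.1))
      (fun b hba => by rw [hW]; exact (hb b hba).1.1)
    have h₂ := union hF s' hs' (fun b => (W b).2) a
      (fun b c hbc hca => (hlt' b c hbc).trans (by rw [hW]; exact (hb c hca).2.2.1))
      (fun b hba => (hsu' b).trans (by rw [hW]; exact (hb b hba).2.2.1))
      (fun b hba => by rw [hW]; exact (hb b hba).2.1)
    exact ⟨h₁.2, h₂.2, h₁.1, h₂.1⟩
  have hgood := fun b => hV b (u b) (u' b) (main b).1 (main b).2.1 (hsu b) (hsu' b)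
  refine ⟨u, fun a => (W a).1, u', fun a => (W a).2, fun a => M a (u a) (u' a), ?_, ?_⟩
  · refine ⟨fun a => ?_, hlt, fun a => ?_, fun ε hε => ?_, fun a b x y h => ?_, fun a x => ?_⟩
    · rw [hW]; exact (hgood a).1.2.1
    · rw [hW]; exact (hgood a).1.1
    · obtain ⟨a, ha⟩ := hcof ε hε
      refine ⟨a, fun x y h => ?_⟩
      rw [hW]; exact (hgood a).1.2.2.1 (ha x y h)
    · exact ((main b).2.2.1 x y h).imp_left fun h => hsu a h
    · rw [hW]; exact (hgood a).1.2.2.2 x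
  · refine ⟨fun a => ?_, hlt', fun a => ?_, fun ε hε => ?_, fun a b x y h => ?_, fun a x => ?_⟩
    · rw [hW]; exact (hgood a).2.2.1
    · rw [hW]; exact (hgood a).2.1
    · obtain ⟨a, ha⟩ := hcof' ε hε
      refine ⟨a, fun x y h => ?_⟩
      rw [hW]; exact (hgood a).2.2.2.1 (ha x y h)
    · exact ((main b).2.2.2 x y h).imp_left fun h => hsu' a h
    · rw [hW]; exact (hgood a).2.2.2.2 x

end Ballean

/-! ### Distributing finite clusters into bins with bounded error -/

theorem exists_subset_sum_near {ι : Type*} (w : ι → ℝ) {S : ℝ} (hw : ∀ i, 0 ≤ w i)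
    (hwS : ∀ i, w i ≤ S) (s : Finset ι) (t : ℝ) (ht : -S ≤ t) (hts : t ≤ ∑ i ∈ s, w i + S) :
    ∃ G ⊆ s, |∑ i ∈ G, w i - t| ≤ S := by
  classical
  induction s using Finset.induction_on with
  | empty =>
    refine ⟨∅, subset_rfl, ?_⟩
    simp only [Finset.sum_empty] at hts ⊢
    rw [abs_le]
    constructor <;> linarith
  | insert i s hi ih =>
    -- Adding one weight moves the sum by at most `S`, so if the smaller set cannot reach the
    -- target, the whole set lies within `S` of it.
    by_cases h : t ≤ ∑ i ∈ s, w i + S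
    · obtain ⟨G, hG, h⟩ := ih h
      exact ⟨G, hG.trans (Finset.subset_insert _ _), h⟩
    · refine ⟨insert i s, subset_rfl, ?_⟩
      rw [Finset.sum_insert hi] at hts ⊢
      have := hw i
      have := hwS i
      rw [abs_le]
      constructor <;> linarith

/-- Bins are filled one at a time from the default bin `j₀`. Each new bin aims at its capacity minus
the error accumulated so far, which keeps the total error at most `S` and each single error at most
`2 * S`. -/
theorem exists_assignment_aux {ι J : Type*} [DecidableEq J] (w : ι → ℝ) {S : ℝ}
    (hw : ∀ i, 0 ≤ w i) (hwS : ∀ i, w i ≤ S) (hS : 0 ≤ S) (c : J → ℝ) (hc : ∀ j, 0 ≤ c j) (j₀ : J)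
    (t : Finset J) (hj₀ : j₀ ∉ t) (s : Finset ι) (hts : ∑ j ∈ t, c j ≤ ∑ i ∈ s, w i + S) :
    ∃ g : ι → J, (∀ i, g i ∈ insert j₀ t) ∧ (∀ i ∉ s, g i = j₀) ∧
      (∀ j ∈ t, |∑ i ∈ s with g i = j, w i - c j| ≤ 2 * S) ∧
      |∑ i ∈ s with g i ≠ j₀, w i - ∑ j ∈ t, c j| ≤ S := by
  classical
  induction t using Finset.induction_on with
  | empty => exact ⟨fun _ => j₀, by simp, by simp, by simp, by simpa using hS⟩
  | insert j t hj ih =>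
    rw [Finset.mem_insert, not_or] at hj₀
    rw [Finset.sum_insert hj] at hts
    obtain ⟨g, hg₁, hg₂, hg₃, hg₄⟩ := ih hj₀.2 (by linarith [hc j])
    have hsplit := Finset.sum_filter_add_sum_filter_not s (fun i => g i = j₀) w
    rw [abs_le] at hg₄
    obtain ⟨G, hG, hGs⟩ := exists_subset_sum_near w hw hwS (s.filter fun i => g i = j₀)
      (c j - (∑ i ∈ s with g i ≠ j₀, w i - ∑ j ∈ t, c j)) (by linarith [hc j]) (by linarith)
    have hG₀ : ∀ i ∈ G, i ∈ s ∧ g i = j₀ := fun i hi => Finset.mem_filter.1 (hG hi)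
    have hgj : ∀ i, g i ≠ j := fun i h => by
      have := hg₁ i
      rw [h, Finset.mem_insert] at this
      exact this.elim (fun h => hj₀.1 h.symm) hj
    refine ⟨fun i => if i ∈ G then j else g i, fun i => ?_, fun i hi => ?_, fun k hk => ?_, ?_⟩
    · dsimp only
      split_ifs
      · simp
      · have := hg₁ i
        simp only [Finset.mem_insert] at this ⊢
        tauto
    · dsimp only
      rw [if_neg fun h => hi (hG₀ i h).1, hg₂ i hi]
    · obtain rfl | hk := Finset.mem_insert.1 hk
      · have : s.filter (fun i => (if i ∈ G then k else g i) = k) = G := by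
          ext i
          simp only [Finset.mem_filter]
          constructor
          · rintro ⟨-, h⟩
            by_contra hi
            rw [if_neg hi] at h
            exact hgj i h
          · exact fun hi => ⟨(hG₀ i hi).1, if_pos hi⟩
        rw [this]
        rw [abs_le] at hGs ⊢
        constructor <;> linarith
      · have : s.filter (fun i => (if i ∈ G then j else g i) = k) = s.filter (fun i => g i = k) := by
          ext i
          simp only [Finset.mem_filter]
          refine and_congr_right fun _ => ?_
          split_ifs with hi
          · rw [(hG₀ i hi).2]
            exact ⟨fun h => absurd (h ▸ hk) hj, fun h => absurd (h ▸ hk) hj₀.2⟩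
          · exact Iff.rfl
        rw [this]
        exact hg₃ k hk
    · have : s.filter (fun i => (if i ∈ G then j else g i) ≠ j₀) =
          G ∪ s.filter (fun i => g i ≠ j₀) := by
        ext i
        simp only [Finset.mem_filter, Finset.mem_union]
        split_ifs with hi
        · simp [hi, (hG₀ i hi).1, Ne.symm hj₀.1]
        · simp [hi]
      rw [this, Finset.sum_union, Finset.sum_insert hj]
      · rw [abs_le] at hGs ⊢
        constructor <;> linarith
      · refine Finset.disjoint_left.2 fun i hi hi' => ?_
        exact (Finset.mem_filter.1 hi').2 (hG₀ i hi).2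

/-- Points of a finite set, coming in clusters of size at most `S`, can be distributed to bins of
prescribed capacities up to an error of `2 * S`, without breaking clusters. -/
theorem exists_splitting {X J : Type*} [DecidableEq J] (C : Finset X) (a : Setoid X)
    [DecidableRel fun x y => a x y] {S : ℝ}
    (hS : ∀ x ∈ C, ((C.filter fun x' => a x x').card : ℝ) ≤ S) (t : Finset J) (c : J → ℝ)
    (hc : ∀ j, 0 ≤ c j) (hsum : ∑ j ∈ t, c j = C.card) {j₀ : J} (hj₀ : j₀ ∈ t) {x₀ : X}
    (hx₀ : x₀ ∈ C) :
    ∃ g : X → J, (∀ x x', a x x' → g x = g x') ∧ g x₀ = j₀ ∧ (∀ x, g x ∈ t) ∧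
      ∀ j ∈ t, |((C.filter fun x => g x = j).card : ℝ) - c j| ≤ 2 * S := by
  classical
  have hS0 : 0 ≤ S := (Nat.cast_nonneg _).trans (hS x₀ hx₀)
  let w : Quotient a → ℝ := fun q => ((C.filter fun x => Quotient.mk a x = q).card : ℝ)
  have hw : ∀ q, 0 ≤ w q := fun q => Nat.cast_nonneg _
  have hwS : ∀ q, w q ≤ S := by
    intro q
    by_cases hq : ∃ x ∈ C, Quotient.mk a x = q
    · obtain ⟨x, hx, rfl⟩ := hq
      refine le_trans ?_ (hS x hx)
      refine Nat.cast_le.2 (Finset.card_le_card fun y hy => ?_)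
      rw [Finset.mem_filter] at hy ⊢
      exact ⟨hy.1, a.symm (Quotient.exact hy.2)⟩
    · have : w q = 0 := by
        simp only [w, Nat.cast_eq_zero, Finset.card_eq_zero, Finset.filter_eq_empty_iff]
        exact fun x hx h => hq ⟨x, hx, h⟩
      rwa [this]
  let s := C.image (Quotient.mk a)
  have hfib : ∀ (P : Quotient a → Prop) [DecidablePred P], ∑ q ∈ s with P q, w q =
      ((C.filter fun x => P (Quotient.mk a x)).card : ℝ) := by
    intro P _
    rw [Finset.card_eq_sum_card_fiberwise (f := Quotient.mk a) (t := s.filter P), Nat.cast_sum]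
    · refine Finset.sum_congr rfl fun q hq => ?_
      simp only [w]
      congr 2
      ext x
      simp only [Finset.mem_filter] at hq ⊢
      exact ⟨fun h => ⟨⟨h.1, h.2 ▸ hq.2⟩, h.2⟩, fun h => ⟨h.1.1, h.2⟩⟩
    · intro x hx
      have hx := Finset.mem_filter.1 (Finset.mem_coe.1 hx)
      exact Finset.mem_coe.2 (Finset.mem_filter.2 ⟨Finset.mem_image_of_mem _ hx.1, hx.2⟩)
  have htot : ∑ q ∈ s, w q = C.card := by simpa using hfib fun _ => True
  have hq₀ : Quotient.mk a x₀ ∈ s := Finset.mem_image_of_mem _ hx₀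
  have herase := Finset.add_sum_erase s w hq₀
  have herase' := Finset.add_sum_erase t c hj₀
  -- Removing the cluster of `x₀` from the distribution forces it into the default bin `j₀`. The
  -- error of that bin is controlled by the total error of the others.
  obtain ⟨g, hg₁, hg₂, hg₃, hg₄⟩ := exists_assignment_aux w hw hwS hS0 c hc j₀ (t.erase j₀)
    (by simp) (s.erase (Quotient.mk a x₀)) (by linarith [hc j₀, hwS (Quotient.mk a x₀)])
  have hg₀ : g (Quotient.mk a x₀) = j₀ := hg₂ _ (by simp)
  have hfilter : ∀ (P : J → Prop) [DecidablePred P], ¬ P j₀ →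
      (s.erase (Quotient.mk a x₀)).filter (fun q => P (g q)) = s.filter fun q => P (g q) := by
    intro P _ hP
    ext q
    simp only [Finset.mem_filter, Finset.mem_erase]
    refine ⟨fun h => ⟨h.1.2, h.2⟩, fun h => ⟨⟨?_, h.1⟩, h.2⟩⟩
    rintro rfl
    exact hP (hg₀ ▸ h.2)
  rw [Finset.insert_erase hj₀] at hg₁
  refine ⟨fun x => g (Quotient.mk a x), fun x x' h => congrArg g (Quotient.sound h), hg₀,
    fun x => hg₁ _, fun j hj => ?_⟩
  by_cases hjj : j = j₀
  · subst hjj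
    rw [hfilter (fun k => k ≠ j) (by simp)] at hg₄
    have hsplit := Finset.sum_filter_add_sum_filter_not s (fun q => g q = j) w
    rw [← hfib fun q => g q = j]
    rw [abs_le] at hg₄ ⊢
    constructor <;> linarith
  · have := hg₃ j (Finset.mem_erase.2 ⟨hjj, hj⟩)
    rw [hfilter (fun k => k = j) (Ne.symm hjj)] at this
    rwa [← hfib fun q => g q = j]

/-! ### Approximate matching of finite towers -/

/-- An increasing sequence of equivalence relations with finite classes, whose sizes at level `n`
lie between `s n` and `S n`. -/
structure FiniteTower {X : Type*} (A : ℕ → Setoid X) (s S : ℕ → ℝ) : Prop where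
  mono : Monotone A
  finite : ∀ n x, {y | A n x y}.Finite
  lower : ∀ n x, s n ≤ (finite n x).toFinset.card
  upper : ∀ n x, ((finite n x).toFinset.card : ℝ) ≤ S n

/-- A relation shifting the levels of two towers by at most `2`. -/
def IsLevelRelation {X Y : Type*} (A : ℕ → Setoid X) (B : ℕ → Setoid Y) (R : X → Y → Prop) : Prop :=
  ∀ i x x' y y', R x y → R x' y' → (A i x x' → B (i + 2) y y') ∧ (B i y y' → A (i + 2) x x')

/-- Here `m` is the size of a class, `p` the capacity proportional to it and `k` the size obtained
after rounding. The rounding error is at most `ε * m / 8`, so the ratio bound degrades only from `1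
+ ε` to `1 + 2 * ε`. -/
theorem ratio_step {m k p ε σ : ℝ} (hε : 0 < ε) (hε' : ε ≤ 1 / 4) (hm : 0 ≤ m)
    (h₁ : m ≤ (1 + ε) * p) (h₂ : p ≤ (1 + ε) * m) (hσ : 16 * σ ≤ ε * m) (hk : |k - p| ≤ 2 * σ) :
    m ≤ (1 + 2 * ε) * k ∧ k ≤ (1 + 2 * ε) * m := by
  rw [abs_le] at hk
  have hεm : 0 ≤ ε * m := by positivity
  have hp : (1 - ε) * m ≤ p := by
    have hp0 : 0 ≤ p := by
      by_contra h
      push Not at h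
      nlinarith
    have : (1 - ε) * m ≤ (1 - ε) * ((1 + ε) * p) := by gcongr; linarith
    nlinarith [mul_nonneg (sq_nonneg ε) hp0]
  constructor
  · have h3 : (1 - ε - ε / 8) * m ≤ k := by linarith
    have h4 : (1 + 2 * ε) * ((1 - ε - ε / 8) * m) ≤ (1 + 2 * ε) * k := by gcongr
    have h5 : ε * (ε * m) ≤ 1 / 4 * (ε * m) := by gcongr
    nlinarith
  · linarith

/-- For the inductive step, `C` is cut along `A n`-classes into pieces proportional to the `B (n +
1)`-classes in `D`. Each such class and its piece satisfy the hypotheses at level `n` with the two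
sides exchanged, which is why the spaces are quantified after `n`. The allowed ratio doubles its
excess at each descent, and the growth of `s` absorbs the rounding. The shift by `2` covers pairs
not in a common piece. -/
theorem exists_levelRelation_finset {s S : ℕ → ℝ} (hs : ∀ n, 2 ^ (n + 6) * S n ≤ s (n + 1))
    (hS : ∀ n, 0 < S n) (n : ℕ) :
    ∀ {X Y : Type u} {A : ℕ → Setoid X} {B : ℕ → Setoid Y}, FiniteTower A s S →
    FiniteTower B s S → ∀ (C : Finset X) (D : Finset Y) (x₀ : X) (y₀ : Y),
    (∀ x, x ∈ C ↔ A (n + 1) x₀ x) → (∀ y ∈ D, B (n + 2) y₀ y) →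
    (∀ y ∈ D, ∀ y', B n y y' → y' ∈ D) → y₀ ∈ D →
    (D.card : ℝ) ≤ (1 + (1 / 2) ^ (n + 1)) * C.card →
    (C.card : ℝ) ≤ (1 + (1 / 2) ^ (n + 1)) * D.card →
    ∃ R : X → Y → Prop, R x₀ y₀ ∧ (∀ x y, R x y → x ∈ C ∧ y ∈ D) ∧ (∀ x ∈ C, ∃ y, R x y) ∧
      (∀ y ∈ D, ∃ x, R x y) ∧ IsLevelRelation A B R := by
  induction n with
  | zero =>
    intro X Y A B hA hB C D x₀ y₀ hC hD _ hy₀ _ _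
    have hx₀ : x₀ ∈ C := (hC x₀).2 ((A _).refl _)
    refine ⟨fun x y => x ∈ C ∧ y ∈ D, ⟨hx₀, hy₀⟩, fun _ _ h => h, fun x hx => ⟨y₀, hx, hy₀⟩,
      fun y hy => ⟨x₀, hx₀, hy⟩, ?_⟩
    rintro i x x' y y' ⟨hx, hy⟩ ⟨hx', hy'⟩
    exact ⟨fun _ => hB.mono (by omega) ((B 2).trans ((B 2).symm (hD y hy)) (hD y' hy')),
      fun _ => hA.mono (by omega) ((A 1).trans ((A 1).symm ((hC x).1 hx)) ((hC x').1 hx'))⟩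
  | succ n ih =>
    intro X Y A B hA hB C D x₀ y₀ hC hD hDB hy₀ hDC hCD
    classical
    have hx₀ : x₀ ∈ C := (hC x₀).2 ((A _).refl _)
    let t := D.image (Quotient.mk (B (n + 1)))
    let fib : Quotient (B (n + 1)) → Finset Y := fun d =>
      D.filter fun y => Quotient.mk (B (n + 1)) y = d
    have hDpos : (0 : ℝ) < D.card := Nat.cast_pos.2 (Finset.card_pos.2 ⟨y₀, hy₀⟩)
    let c : Quotient (B (n + 1)) → ℝ := fun d => (fib d).card * (C.card / D.card)
    have hsum : ∑ d ∈ t, c d = C.card := by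
      rw [← Finset.sum_mul, ← Nat.cast_sum,
        ← Finset.card_eq_sum_card_fiberwise fun y hy => Finset.mem_image_of_mem _ hy]
      field_simp
    obtain ⟨g, hg₁, hg₂, hg₃, hg₄⟩ := exists_splitting C (A n) (S := S n) (fun x hx => by
        refine le_trans (Nat.cast_le.2 (Finset.card_le_card fun y hy => ?_)) (hA.upper n x)
        simpa using (Finset.mem_filter.1 hy).2) t c (fun d => by positivity) hsum
      (Finset.mem_image_of_mem _ hy₀) hx₀
    have hfib : ∀ d ∈ t, ∀ y, y ∈ fib d ↔ Quotient.mk (B (n + 1)) y = d := by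
      intro d hd y
      obtain ⟨y₁, hy₁, rfl⟩ := Finset.mem_image.1 hd
      simp only [fib, Finset.mem_filter, and_iff_right_iff_imp]
      exact fun h => hDB y₁ hy₁ y ((B _).symm (Quotient.exact h))
    have hε : ((1 : ℝ) / 2) ^ (n + 1) = 2 * (1 / 2) ^ (n + 1 + 1) := by ring
    have hratio : ∀ d ∈ t, 0 < ((fib d).card : ℝ) ∧
        ((fib d).card : ℝ) ≤ (1 + (1 / 2) ^ (n + 1)) * (C.filter fun x => g x = d).card ∧
        ((C.filter fun x => g x = d).card : ℝ) ≤ (1 + (1 / 2) ^ (n + 1)) * (fib d).card := by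
      intro d hd
      have hlow : 2 ^ (n + 6) * S n ≤ (fib d).card := by
        obtain ⟨y₁, hy₁, rfl⟩ := Finset.mem_image.1 hd
        refine (hs n).trans ((hB.lower (n + 1) y₁).trans (Nat.cast_le.2 (Finset.card_le_card ?_)))
        intro y hy
        rw [hfib _ hd]
        exact Quotient.sound ((B _).symm (by simpa using hy))
      have hpow : (0 : ℝ) < 2 ^ (n + 6) := by positivity
      have hpow' : ((1 : ℝ) / 2) ^ (n + 1 + 1) * 2 ^ (n + 6) = 16 := by
        rw [one_div, inv_pow, show n + 6 = (n + 1 + 1) + 4 by omega, pow_add]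
        field_simp
        ring
      refine ⟨(mul_pos hpow (hS n)).trans_le hlow, ?_⟩
      rw [hε]
      refine ratio_step (p := c d) (σ := S n) (by positivity) ?_ (Nat.cast_nonneg _) ?_ ?_ ?_
        (hg₄ d hd)
      · have : ((1 : ℝ) / 2) ^ (n + 1 + 1) ≤ (1 / 2) ^ 2 :=
          pow_le_pow_of_le_one (by norm_num) (by norm_num) (by omega)
        linarith
      · have : 1 ≤ (1 + (1 / 2) ^ (n + 1 + 1)) * ((C.card : ℝ) / D.card) := by
          rw [← mul_div_assoc, one_le_div hDpos]
          exact hDC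
        calc ((fib d).card : ℝ) = (fib d).card * 1 := (mul_one _).symm
          _ ≤ (fib d).card * ((1 + (1 / 2) ^ (n + 1 + 1)) * ((C.card : ℝ) / D.card)) := by gcongr
          _ = _ := by simp only [c]; ring
      · have : (C.card : ℝ) / D.card ≤ 1 + (1 / 2) ^ (n + 1 + 1) := by
          rw [div_le_iff₀ hDpos]
          exact hCD
        calc c d ≤ (fib d).card * (1 + (1 / 2) ^ (n + 1 + 1)) := by simp only [c]; gcongr
          _ = _ := by ring
      · calc 16 * S n = (1 / 2) ^ (n + 1 + 1) * (2 ^ (n + 6) * S n) := by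
              rw [← mul_assoc, hpow']
          _ ≤ _ := by gcongr
    -- The recursive call needs a base pair in each piece; in the piece of `y₀` it must be `(x₀,
    -- y₀)`, so that this pair stays related.
    have hpt : ∀ d ∈ t, ∃ x y, x ∈ C ∧ g x = d ∧ y ∈ fib d ∧
        (d = Quotient.mk _ y₀ → x = x₀ ∧ y = y₀) := by
      intro d hd
      by_cases hd₀ : d = Quotient.mk _ y₀
      · exact ⟨x₀, y₀, hx₀, hg₂.trans hd₀.symm, (hfib d hd _).2 hd₀.symm, fun _ => ⟨rfl, rfl⟩⟩
      · obtain ⟨h₁, h₂, -⟩ := hratio d hd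
        obtain ⟨y, hy⟩ := Finset.card_pos.1 (Nat.cast_pos.1 h₁)
        have h₃ : (C.filter fun x => g x = d).Nonempty := by
          by_contra h
          rw [Finset.not_nonempty_iff_eq_empty] at h
          rw [h] at h₂
          simp only [Finset.card_empty, Nat.cast_zero, mul_zero] at h₂
          linarith
        obtain ⟨x, hx⟩ := h₃
        rw [Finset.mem_filter] at hx
        exact ⟨x, y, hx.1, hx.2, hy, fun h => absurd h hd₀⟩
    have hex : ∀ d ∈ t, ∃ R : Y → X → Prop, (d = Quotient.mk _ y₀ → R y₀ x₀) ∧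
        (∀ y x, R y x → y ∈ fib d ∧ x ∈ C.filter fun x => g x = d) ∧ (∀ y ∈ fib d, ∃ x, R y x) ∧
        (∀ x ∈ C.filter fun x => g x = d, ∃ y, R y x) ∧ IsLevelRelation B A R := by
      intro d hd
      obtain ⟨x, y, hx, hgx, hy, h₀⟩ := hpt d hd
      obtain ⟨R, hR, h⟩ := ih hB hA (fib d) (C.filter fun x => g x = d) y x
        (fun y' => by
          rw [hfib d hd, ← (hfib d hd y).1 hy]
          exact ⟨fun h => (B _).symm (Quotient.exact h), fun h => Quotient.sound ((B _).symm h)⟩)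
        (fun x' hx' => (A _).trans ((A _).symm ((hC x).1 hx))
          ((hC x').1 (Finset.mem_filter.1 hx').1))
        (fun x' hx' x'' hxx => by
          rw [Finset.mem_filter] at hx' ⊢
          refine ⟨(hC x'').2 ((A _).trans ((hC x').1 hx'.1) (hA.mono (by omega) hxx)), ?_⟩
          rw [← hg₁ _ _ hxx, hx'.2])
        (Finset.mem_filter.2 ⟨hx, hgx⟩) (hratio d hd).2.2 (hratio d hd).2.1
      refine ⟨R, fun hd₀ => ?_, h⟩
      obtain ⟨rfl, rfl⟩ := h₀ hd₀
      exact hR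
    choose! R hR₀ hR₁ hR₂ hR₃ hR₄ using hex
    have hyt : ∀ y ∈ D, Quotient.mk (B (n + 1)) y ∈ t := fun y hy => Finset.mem_image_of_mem _ hy
    refine ⟨fun x y => ∃ d ∈ t, R d y x, ⟨_, hyt y₀ hy₀, hR₀ _ (hyt y₀ hy₀) rfl⟩, ?_, ?_, ?_, ?_⟩
    · rintro x y ⟨d, hd, h⟩
      exact ⟨(Finset.mem_filter.1 (hR₁ d hd _ _ h).2).1, (Finset.mem_filter.1 (hR₁ d hd _ _ h).1).1⟩
    · intro x hx
      obtain ⟨y, hy⟩ := hR₃ (g x) (hg₃ x) x (Finset.mem_filter.2 ⟨hx, rfl⟩)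
      exact ⟨y, _, hg₃ x, hy⟩
    · intro y hy
      obtain ⟨x, hx⟩ := hR₂ _ (hyt y hy) y ((hfib _ (hyt y hy) y).2 rfl)
      exact ⟨x, _, hyt y hy, hx⟩
    · rintro i x x' y y' ⟨d, hd, h⟩ ⟨d', hd', h'⟩
      have hx := Finset.mem_filter.1 (hR₁ d hd _ _ h).2
      have hx' := Finset.mem_filter.1 (hR₁ d' hd' _ _ h').2
      have hy := (hR₁ d hd _ _ h).1
      have hy' := (hR₁ d' hd' _ _ h').1
      constructor
      · intro hxx
        by_cases hi : i ≤ n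
        · have : d = d' := by rw [← hx.2, ← hx'.2, hg₁ _ _ (hA.mono hi hxx)]
          subst this
          exact (hR₄ d hd i _ _ _ _ h h').2 hxx
        · refine hB.mono (a := n + 1 + 2) (by omega) ?_
          exact (B _).trans ((B _).symm (hD y (Finset.mem_filter.1 hy).1))
            (hD y' (Finset.mem_filter.1 hy').1)
      · intro hyy
        by_cases hi : i ≤ n + 1
        · have : d = d' := by
            rw [← (hfib d hd y).1 hy, ← (hfib d' hd' y').1 hy']
            exact Quotient.sound (hB.mono hi hyy)
          subst this
          exact (hR₄ d hd i _ _ _ _ h h').1 hyy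
        · refine hA.mono (a := n + 1 + 1) (by omega) ?_
          exact (A _).trans ((A _).symm ((hC x).1 hx.1)) ((hC x').1 hx'.1)

/-- Finite matchings around `(x₀, y₀)` are combined along a nonprincipal ultrafilter. Since `x₀` and
`y₀` are always related, the partners of a given point stay in one finite class, so one of them
works for almost all `n`. -/
theorem exists_levelRelation {s S : ℕ → ℝ} (hs : ∀ n, 2 ^ (n + 6) * S n ≤ s (n + 1))
    (hS : ∀ n, 0 < S n) {X Y : Type u} [Nonempty X] [Nonempty Y] {A : ℕ → Setoid X}
    {B : ℕ → Setoid Y} (hA : FiniteTower A s S) (hB : FiniteTower B s S)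
    (hA' : ∀ x x', ∃ n, A n x x') (hB' : ∀ y y', ∃ n, B n y y') :
    ∃ R : X → Y → Prop, (∀ x, ∃ y, R x y) ∧ (∀ y, ∃ x, R x y) ∧ IsLevelRelation A B R := by
  classical
  obtain ⟨x₀⟩ := ‹Nonempty X›
  obtain ⟨y₀⟩ := ‹Nonempty Y›
  have hex : ∀ n : ℕ, ∃ R : X → Y → Prop, R x₀ y₀ ∧ (∀ x, A (n + 1) x₀ x → ∃ y, R x y) ∧
      (∀ y, B n y₀ y → ∃ x, R x y) ∧ IsLevelRelation A B R := by
    intro n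
    let C := (hA.finite (n + 1) x₀).toFinset
    let T := (hB.finite (n + 2) y₀).toFinset
    have hT : ∀ y, y ∈ T ↔ B (n + 2) y₀ y := fun y => by simp [T]
    have hSC : 2 ^ (n + 6) * S n ≤ (C.card : ℝ) := (hs n).trans (hA.lower (n + 1) x₀)
    have hCT : (C.card : ℝ) ≤ T.card := by
      refine (hA.upper (n + 1) x₀).trans (le_trans ?_ ((hs (n + 1)).trans (hB.lower (n + 2) y₀)))
      exact le_mul_of_one_le_left (hS _).le (one_le_pow₀ (by norm_num))
    have hy₀ : y₀ ∈ T := (hT y₀).2 ((B _).refl _)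
    -- Two bins cut from the larger class `T` a union of `B n`-classes that contains `y₀` and has
    -- nearly the size of `C`.
    obtain ⟨g, hg₁, hg₂, -, hg₃⟩ := exists_splitting T (B n) (S := S n) (fun y hy => by
        refine le_trans (Nat.cast_le.2 (Finset.card_le_card fun y' hy' => ?_)) (hB.upper n y)
        simpa using (Finset.mem_filter.1 hy').2) (Finset.univ : Finset Bool)
      (fun b => if b then C.card else T.card - C.card)
      (fun b => by cases b <;> simp [hCT]) (by simp) (Finset.mem_univ true) hy₀
    have hg := hg₃ true (Finset.mem_univ _)
    simp only [if_true, abs_le] at hg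
    have hpow : ((1 : ℝ) / 2) ^ (n + 1) * 2 ^ (n + 6) = 32 := by
      rw [one_div, inv_pow, show n + 6 = (n + 1) + 5 by omega, pow_add 2 (n + 1)]
      field_simp
      norm_num
    have hε : ((1 : ℝ) / 2) ^ (n + 1) ≤ 1 := pow_le_one₀ (by norm_num) (by norm_num)
    have hε' : (0 : ℝ) < (1 / 2) ^ (n + 1) := by positivity
    have hC' : 32 * S n ≤ (1 / 2) ^ (n + 1) * (C.card : ℝ) := by
      rw [← hpow, mul_assoc]
      gcongr
    have hSn := hS n
    obtain ⟨R, hR₀, -, hR₁, hR₂, hR₃⟩ := exists_levelRelation_finset hs hS n hA hB C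
      (T.filter fun y => g y = true) x₀ y₀ (fun x => by simp [C])
      (fun y hy => (hT y).1 (Finset.mem_filter.1 hy).1)
      (fun y hy y' h => by
        rw [Finset.mem_filter] at hy ⊢
        exact ⟨(hT y').2 ((B _).trans ((hT y).1 hy.1) (hB.mono (by omega) h)),
          (hg₁ _ _ h).symm.trans hy.2⟩)
      (Finset.mem_filter.2 ⟨hy₀, hg₂⟩) (by nlinarith) (by nlinarith)
    refine ⟨R, hR₀, fun x hx => hR₁ x (by simpa [C] using hx), fun y hy => hR₂ y ?_, hR₃⟩
    exact Finset.mem_filter.2 ⟨(hT y).2 (hB.mono (by omega) hy), (hg₁ _ _ hy).symm.trans hg₂⟩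
  choose R hR₀ hR₁ hR₂ hR₃ using hex
  let U := Filter.hyperfilter ℕ
  have hU : ∀ k : ℕ, ∀ᶠ n in U, k ≤ n := fun k =>
    Nat.hyperfilter_le_atTop (Filter.eventually_ge_atTop k)
  refine ⟨fun x y => ∀ᶠ n in U, R n x y, fun x => ?_, fun y => ?_, fun i x x' y y' h h' => ?_⟩
  · obtain ⟨k, hk⟩ := hA' x₀ x
    obtain ⟨y, -, hy⟩ := (Ultrafilter.eventually_exists_mem_iff (f := U)
      (P := fun y n => R n x y) (hB.finite (k + 2) y₀)).1 (by
        filter_upwards [hU k] with n hn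
        obtain ⟨y, hy⟩ := hR₁ n x (hA.mono (by omega) hk)
        exact ⟨y, ((hR₃ n) k _ _ _ _ (hR₀ n) hy).1 hk, hy⟩)
    exact ⟨y, hy⟩
  · obtain ⟨k, hk⟩ := hB' y₀ y
    obtain ⟨x, -, hx⟩ := (Ultrafilter.eventually_exists_mem_iff (f := U)
      (P := fun x n => R n x y) (hA.finite (k + 2) x₀)).1 (by
        filter_upwards [hU k] with n hn
        obtain ⟨x, hx⟩ := hR₂ n y (hB.mono hn hk)
        exact ⟨x, ((hR₃ n) k _ _ _ _ (hR₀ n) hx).2 hk, hx⟩)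
    exact ⟨x, hx⟩
  · obtain ⟨n, h₁, h₂⟩ := (h.and h').exists
    exact hR₃ n i x x' y y' h₁ h₂

/-! ### The case `θ = ℵ₀` -/

theorem numClasses_eq_mk_comap_out {X : Type u} {s t : Setoid X} (hst : s ≤ t) (q : Quotient s) :
    numClasses s t q.out = #{q' | t.comap Quotient.out q q'} := by
  unfold numClasses
  congr 2
  ext q'
  constructor
  · rintro ⟨y, hy, rfl⟩
    exact t.trans hy (hst (s.symm (Quotient.mk_out y)))
  · intro h
    exact ⟨q'.out, h, Quotient.out_eq q'⟩

theorem comap_out_mk_iff {X : Type u} {s t : Setoid X} (hst : s ≤ t) (x y : X) :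
    t.comap Quotient.out (Quotient.mk s x) (Quotient.mk s y) ↔ t x y := by
  have h : ∀ z, t (Quotient.mk s z).out z := fun z => hst (Quotient.mk_out z)
  exact ⟨fun hxy => t.trans (t.symm (h x)) (t.trans hxy (h y)),
    fun hxy => t.trans (h x) (t.trans hxy (t.symm (h y)))⟩

/-- Classes may be infinite in `X`; only their numbers of `σ`-classes are finite, so the tower lives
on the quotient by `σ`. -/
theorem finiteTower_comap_out {X : Type u} {σ : Setoid X} {v : ℕ → Setoid X} (hv : Monotone v)
    (hσ : ∀ n, σ ≤ v n) {m M : ℕ → ℕ} (hm : ∀ n x, (m n : Cardinal) ≤ numClasses σ (v n) x)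
    (hM : ∀ n x, numClasses σ (v n) x ≤ M n) :
    FiniteTower (fun n => (v n).comap (Quotient.out : Quotient σ → X)) (fun n => (m n : ℝ))
      (fun n => (M n : ℝ)) := by
  have hfin : ∀ n (q : Quotient σ), {q' | (v n).comap Quotient.out q q'}.Finite := by
    intro n q
    rw [← lt_aleph0_iff_set_finite, ← numClasses_eq_mk_comap_out (hσ n)]
    exact (hM n _).trans_lt natCast_lt_aleph0
  have hcard : ∀ n q, ((hfin n q).toFinset.card : Cardinal) = numClasses σ (v n) q.out := by
    intro n q
    rw [numClasses_eq_mk_comap_out (hσ n), ← mk_coe_finset]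
    exact mk_congr (Equiv.setCongr (hfin n q).coe_toFinset)
  refine ⟨fun a b hab => ?_, hfin, fun n q => ?_, fun n q => ?_⟩
  · intro x y h
    exact hv hab h
  · have := hm n q.out
    rw [← hcard] at this
    exact_mod_cast this
  · have := hM n q.out
    rw [← hcard] at this
    exact_mod_cast this

namespace Ballean

variable {X Y : Type u} {E : Ballean X} {F : Ballean Y} {κ : Cardinal.{u}}

/-- If `κ` were uncountable, additivity would bound countably many relations with at least `n`
classes each by a single one, against the finite uniform bound from `sharp`. -/
theorem IsTame.le_aleph0 [Nonempty X] (hE : E.IsTame κ ℵ₀) : κ ≤ ℵ₀ := by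
  by_contra! hκ
  obtain ⟨s, hs, hsharp⟩ := hE.sharp
  choose t ht hcard using fun n : ℕ => hE.flat n natCast_lt_aleph0 s hs
  obtain ⟨ε, hε, h⟩ := hE.add (ULift ℕ) (fun n => t n.down) (by simpa using hκ) fun n => ht _
  obtain ⟨w, hw, hεw⟩ := hE.cellular ε hε
  obtain ⟨ν, hν, hle⟩ := hsharp w hw
  obtain ⟨n, rfl⟩ := lt_aleph0.1 hν
  let x := Classical.arbitrary X
  have h' : t (n + 1) ≤ w := fun {x y} hxy => hεw _ _ (h ⟨n + 1⟩ x y hxy)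
  have := (hcard (n + 1) x).trans ((numClasses_mono_right s h' x).trans (hle x))
  rw [Nat.cast_le] at this
  omega

theorem IsTame.exists_sequence [Nonempty X] (hE : E.IsTame κ ℵ₀) (hκ : κ ≠ 0) :
    ∃ e : ℕ → Setoid X, (∀ n, E.Bdd (e n)) ∧ ∀ ε ∈ E.radii, ∃ n, ∀ x y, (x, y) ∈ ε → e n x y := by
  obtain ⟨e, he, hcof⟩ := hE.cof
  have : Countable κ.ord.ToType := by
    rw [← mk_le_aleph0_iff, mk_ord_toType]
    exact hE.le_aleph0
  have : Nonempty κ.ord.ToType := by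
    rw [← mk_ne_zero_iff, mk_ord_toType]
    exact hκ
  obtain ⟨f, hf⟩ := exists_surjective_nat κ.ord.ToType
  refine ⟨fun n => e (f n), fun n => he _, fun ε hε => ?_⟩
  obtain ⟨a, ha⟩ := hcof ε hε
  obtain ⟨n, rfl⟩ := hf a
  exact ⟨n, ha⟩

theorem IsTame.exists_large (hE : E.IsTame κ ℵ₀) {s t t' : Setoid X} (hs : E.Bdd s) (ht : E.Bdd t)
    (ht' : E.Bdd t') (m : ℕ) :
    ∃ w, E.Bdd w ∧ t ≤ w ∧ t' ≤ w ∧ ∀ x, (m : Cardinal) ≤ numClasses s w x := by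
  obtain ⟨z, hz, hm⟩ := hE.flat m natCast_lt_aleph0 s hs
  obtain ⟨w, hw, h₁, h₂⟩ := hE.exists_ge ht ht'
  obtain ⟨w', hw', h₃, h₄⟩ := hE.exists_ge hz hw
  exact ⟨w', hw', h₁.trans h₄, h₂.trans h₄, fun x => (hm x).trans (numClasses_mono_right s h₃ x)⟩

theorem exists_relation_aleph0 [Nonempty X] [Nonempty Y] (hE : E.IsTame κ ℵ₀) (hF : F.IsTame κ ℵ₀)
    (hκ : κ ≠ 0) : ∃ R : X → Y → Prop, (∀ x, ∃ y, R x y) ∧ (∀ y, ∃ x, R x y) ∧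
      E.Controlled F R ∧ F.Controlled E (fun y x => R x y) := by
  obtain ⟨σ, hσ, hsharp⟩ := hE.sharp
  obtain ⟨σ', hσ', hsharp'⟩ := hF.sharp
  obtain ⟨e, he, hcof⟩ := hE.exists_sequence hκ
  obtain ⟨e', he', hcof'⟩ := hF.exists_sequence hκ
  let P := {p : Setoid X × Setoid Y × ℕ // E.Bdd p.1 ∧ F.Bdd p.2.1 ∧ σ ≤ p.1 ∧ σ' ≤ p.2.1 ∧
    (∀ x, numClasses σ p.1 x ≤ p.2.2) ∧ (∀ y, numClasses σ' p.2.1 y ≤ p.2.2) ∧ 0 < p.2.2}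
  have bound : ∀ v v', E.Bdd v → F.Bdd v' → ∃ M : ℕ, (∀ x, numClasses σ v x ≤ M) ∧
      (∀ y, numClasses σ' v' y ≤ M) ∧ 0 < M := by
    intro v v' hv hv'
    obtain ⟨ν, hν, hle⟩ := hsharp v hv
    obtain ⟨ν', hν', hle'⟩ := hsharp' v' hv'
    obtain ⟨n, rfl⟩ := lt_aleph0.1 hν
    obtain ⟨n', rfl⟩ := lt_aleph0.1 hν'
    exact ⟨n + n' + 1, fun x => (hle x).trans (Nat.cast_le.2 (by omega)),
      fun y => (hle' y).trans (Nat.cast_le.2 (by omega)), by omega⟩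
  have step : ∀ (n : ℕ) (p : P), ∃ q : P, p.1.1 ≤ q.1.1 ∧ p.1.2.1 ≤ q.1.2.1 ∧ e n ≤ q.1.1 ∧
      e' n ≤ q.1.2.1 ∧ (∀ x, ((2 ^ (n + 6) * p.1.2.2 : ℕ) : Cardinal) ≤ numClasses σ q.1.1 x) ∧
      (∀ y, ((2 ^ (n + 6) * p.1.2.2 : ℕ) : Cardinal) ≤ numClasses σ' q.1.2.1 y) := by
    rintro n ⟨⟨v, v', M⟩, hv, hv', hσv, hσv', -⟩
    obtain ⟨w, hw, h₁, h₂, h₃⟩ := hE.exists_large hσ hv (he n) (2 ^ (n + 6) * M)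
    obtain ⟨w', hw', h₁', h₂', h₃'⟩ := hF.exists_large hσ' hv' (he' n) (2 ^ (n + 6) * M)
    obtain ⟨N, hN⟩ := bound w w' hw hw'
    exact ⟨⟨⟨w, w', N⟩, hw, hw', hσv.trans h₁, hσv'.trans h₁', hN⟩, h₁, h₁', h₂, h₂', h₃, h₃'⟩
  choose next hnext using step
  obtain ⟨M₀, hM₀⟩ := bound σ σ' hσ hσ'
  let p : ℕ → P := fun n => Nat.rec ⟨⟨σ, σ', M₀⟩, hσ, hσ', le_rfl, le_rfl, hM₀⟩ next n
  have hp : ∀ n, p (n + 1) = next n (p n) := fun n => rfl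
  -- Each step enforces these lower bounds, which makes the growth condition of
  -- `exists_levelRelation` an equality; at level `0` no lower bound is needed.
  let m : ℕ → ℕ := fun n => Nat.casesOn n 0 fun k => 2 ^ (k + 6) * (p k).1.2.2
  have hv : Monotone fun n => (p n).1.1 := monotone_nat_of_le_succ fun n => by
    rw [hp]; exact (hnext n (p n)).1
  have hv' : Monotone fun n => (p n).1.2.1 := monotone_nat_of_le_succ fun n => by
    rw [hp]; exact (hnext n (p n)).2.1
  have hσv : ∀ n, σ ≤ (p n).1.1 := fun n => (p n).2.2.2.1
  have hσv' : ∀ n, σ' ≤ (p n).1.2.1 := fun n => (p n).2.2.2.2.1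
  have hA := finiteTower_comap_out (m := m) (M := fun n => (p n).1.2.2) hv hσv
    (fun n x => by
      cases n with
      | zero => simp [m]
      | succ n => exact (hnext n (p n)).2.2.2.2.1 x)
    (fun n => (p n).2.2.2.2.2.1)
  have hB := finiteTower_comap_out (m := m) (M := fun n => (p n).1.2.2) hv' hσv'
    (fun n x => by
      cases n with
      | zero => simp [m]
      | succ n => exact (hnext n (p n)).2.2.2.2.2 x)
    (fun n => (p n).2.2.2.2.2.2.1)
  have hcofv : ∀ ε ∈ E.radii, ∃ n, ∀ x y, (x, y) ∈ ε → (p n).1.1 x y := by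
    intro ε hε
    obtain ⟨n, hn⟩ := hcof ε hε
    exact ⟨n + 1, fun x y h => (hnext n (p n)).2.2.1 (hn x y h)⟩
  have hcofv' : ∀ ε ∈ F.radii, ∃ n, ∀ x y, (x, y) ∈ ε → (p n).1.2.1 x y := by
    intro ε hε
    obtain ⟨n, hn⟩ := hcof' ε hε
    exact ⟨n + 1, fun x y h => (hnext n (p n)).2.2.2.1 (hn x y h)⟩
  have : Nonempty (Quotient σ) := ⟨Quotient.mk σ (Classical.arbitrary X)⟩
  have : Nonempty (Quotient σ') := ⟨Quotient.mk σ' (Classical.arbitrary Y)⟩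
  obtain ⟨R, hR, hR', hlev⟩ := exists_levelRelation (fun n => by simp [m])
    (fun n => Nat.cast_pos.2 (p n).2.2.2.2.2.2.2) hA hB
    (fun q q' => by
      obtain ⟨ε, hε, h⟩ := E.exists_radius q.out q'.out
      obtain ⟨n, hn⟩ := hcofv ε hε
      exact ⟨n, hn _ _ h⟩)
    (fun q q' => by
      obtain ⟨ε, hε, h⟩ := F.exists_radius q.out q'.out
      obtain ⟨n, hn⟩ := hcofv' ε hε
      exact ⟨n, hn _ _ h⟩)
  refine ⟨fun x y => R (Quotient.mk σ x) (Quotient.mk σ' y), fun x => ?_, fun y => ?_, ?_, ?_⟩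
  · obtain ⟨q, hq⟩ := hR (Quotient.mk σ x)
    exact ⟨q.out, by simpa using hq⟩
  · obtain ⟨q, hq⟩ := hR' (Quotient.mk σ' y)
    exact ⟨q.out, by simpa using hq⟩
  · intro ε hε
    obtain ⟨n, hn⟩ := hcofv ε hε
    obtain ⟨δ, hδ, hδv⟩ := (p (n + 2)).2.2.1
    refine ⟨δ, hδ, fun x x' y y' h h' hx => hδv _ _ ((comap_out_mk_iff (hσv' (n + 2)) _ _).1 ?_)⟩
    exact (hlev n _ _ _ _ h h').1 ((comap_out_mk_iff (hσv n) _ _).2 (hn _ _ hx))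
  · intro δ hδ
    obtain ⟨n, hn⟩ := hcofv' δ hδ
    obtain ⟨ε, hε, hεv⟩ := (p (n + 2)).2.1
    refine ⟨ε, hε, fun y y' x x' h h' hy => hεv _ _ ((comap_out_mk_iff (hσv (n + 2)) _ _).1 ?_)⟩
    exact (hlev n _ _ _ _ h h').2 ((comap_out_mk_iff (hσv' n) _ _).2 (hn _ _ hy))

theorem IsTame.coarselyEquivalent [Nonempty X] [Nonempty Y] {θ : Cardinal.{u}}
    (hE : E.IsTame κ θ) (hF : F.IsTame κ θ) (hκ : κ ≠ 0) (hθ : ℵ₀ ≤ θ) :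
    E.CoarselyEquivalent F := by
  have : ∃ R : X → Y → Prop, (∀ x, ∃ y, R x y) ∧ (∀ y, ∃ x, R x y) ∧
      E.Controlled F R ∧ F.Controlled E (fun y x => R x y) := by
    obtain rfl | hθ := hθ.eq_or_lt
    · exact exists_relation_aleph0 hE hF hκ
    · obtain ⟨u, v, u', v', μ, h, h'⟩ := exists_towers hE hF hθ
      exact h.exists_relation h'
  obtain ⟨R, hR, hR', h, h'⟩ := this
  exact coarselyEquivalent_of_relation R hR hR' h h'

end Ballean

/-! ### Invariants of a ballean with a cofinal chain -/

namespace Ballean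

variable {X : Type u} {E : Ballean X}

/-- A chain of bounded equivalence relations cofinal in the coarse structure of an unbounded
ballean. -/
structure IsChain (E : Ballean X) {I : Type u} [LinearOrder I] (v : I → Setoid X) : Prop where
  mono : Monotone v
  bdd : ∀ a, E.Bdd (v a)
  cofinal : ∀ ε ∈ E.radii, ∃ a, ∀ x y, (x, y) ∈ ε → v a x y
  unbounded : ∀ a, ∃ x y, ¬ v a x y

variable {I : Type u} [LinearOrder I] {v : I → Setoid X}

theorem IsChain.isBase (h : E.IsChain v) {s : Set I} (hs : IsCofinal s) :
    E.IsBase ((fun a => {p : X × X | v a p.1 p.2}) '' s) := by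
  refine ⟨?_, ?_⟩
  · rintro _ ⟨a, -, rfl⟩
    exact (h.bdd a).mem_coarse
  · rintro δ ⟨-, ε, hε, hδ⟩
    obtain ⟨a, ha⟩ := h.cofinal ε hε
    obtain ⟨b, hb, hab⟩ := hs a
    exact ⟨_, ⟨b, hb, rfl⟩, fun p hp => h.mono hab (ha _ _ (hδ hp))⟩

theorem IsChain.isCellular (h : E.IsChain v) : E.IsCellular := by
  refine ⟨_, h.isBase IsCofinal.univ, ?_⟩
  rintro _ ⟨a, -, rfl⟩
  exact ⟨⟨(v a).refl, fun _ _ => (v a).symm⟩, fun _ _ _ => (v a).trans⟩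

theorem IsChain.exists_not_le (h : E.IsChain v) (a : I) : ∃ b, ¬ v b ≤ v a := by
  obtain ⟨x, y, hxy⟩ := h.unbounded a
  obtain ⟨ε, hε, hx⟩ := E.exists_radius x y
  obtain ⟨b, hb⟩ := h.cofinal ε hε
  exact ⟨b, fun hle => hxy (hle (hb _ _ hx))⟩

/-- Conversely to cofinal sets giving bases, indices bounding the members of a base are cofinal: for
each `a` some `v a'` is not below `v a`, so a base member containing `v a'` has index at least `a`.
-/
theorem IsChain.cof_eq (h : E.IsChain v) : E.cof = Order.cof I := by
  refine le_antisymm ?_ ?_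
  · obtain ⟨s, hs, hs'⟩ := Order.exists_cof_eq I
    rw [← hs']
    have : E.cof ≤ #((fun a => {p : X × X | v a p.1 p.2}) '' s) := csInf_le' ⟨_, h.isBase hs, rfl⟩
    exact this.trans mk_image_le
  · refine le_csInf ⟨_, E.coarse, E.isBase_coarse, rfl⟩ ?_
    rintro _ ⟨B, hB, rfl⟩
    have hex : ∀ b : B, ∃ a, ∀ x y, (x, y) ∈ b.1 → v a x y := by
      rintro ⟨b, hb⟩
      obtain ⟨-, ε, hε, hbε⟩ := hB.1 hb
      obtain ⟨a, ha⟩ := h.cofinal ε hε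
      exact ⟨a, fun x y hxy => ha x y (hbε hxy)⟩
    choose f hf using hex
    refine (Order.cof_le (s := Set.range f) fun a => ?_).trans mk_range_le
    obtain ⟨a', ha'⟩ := h.exists_not_le a
    obtain ⟨b, hb, hab⟩ := hB.2 _ (h.bdd a').mem_coarse
    refine ⟨f ⟨b, hb⟩, ⟨_, rfl⟩, ?_⟩
    by_contra hlt
    exact ha' fun {x y} hxy => h.mono (not_le.1 hlt).le (hf ⟨b, hb⟩ x y (hab hxy))

/-- Fewer than `Order.cof I` relations have a common bound `v a`, and unboundedness keeps their
union different from `X × X`. A cofinal part of the chain has union `X × X`. -/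
theorem IsChain.add_eq (h : E.IsChain v) [Nonempty I] : E.add = Order.cof I := by
  obtain ⟨s, hs, hs'⟩ := Order.exists_cof_eq I
  have hmem : #((fun a => {p : X × X | v a p.1 p.2}) '' s) ∈ {c | ∃ A : Set (SetRel X X),
      A.Nonempty ∧ A ⊆ E.coarse ∧ ⋃₀ A ∉ E.coarse \ {Set.univ} ∧ #A = c} := by
    refine ⟨_, hs.nonempty.image _, (h.isBase hs).1, fun hA => hA.2 ?_, rfl⟩
    refine Set.eq_univ_of_forall fun p => ?_
    obtain ⟨ε, hε, hp⟩ := E.exists_radius p.1 p.2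
    obtain ⟨a, ha⟩ := h.cofinal ε hε
    obtain ⟨b, hb, hab⟩ := hs a
    exact ⟨_, ⟨b, hb, rfl⟩, h.mono hab (ha _ _ hp)⟩
  refine le_antisymm ?_ ?_
  · rw [← hs']
    exact (csInf_le' hmem).trans mk_image_le
  · refine le_csInf ⟨_, hmem⟩ ?_
    rintro _ ⟨A, ⟨α, hα⟩, hA, hun, rfl⟩
    have hex : ∀ b : A, ∃ a, ∀ x y, (x, y) ∈ b.1 → v a x y := by
      rintro ⟨b, hb⟩
      obtain ⟨-, ε, hε, hbε⟩ := hA hb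
      obtain ⟨a, ha⟩ := h.cofinal ε hε
      exact ⟨a, fun x y hxy => ha x y (hbε hxy)⟩
    choose f hf using hex
    by_contra hlt
    have hcof : ¬ IsCofinal (Set.range f) := fun hc =>
      hlt ((Order.cof_le hc).trans mk_range_le)
    rw [not_isCofinal_iff] at hcof
    obtain ⟨a, ha⟩ := hcof
    have hle : ∀ p ∈ ⋃₀ A, v a p.1 p.2 := by
      rintro p ⟨b, hb, hp⟩
      exact h.mono (ha _ ⟨⟨b, hb⟩, rfl⟩).le (hf ⟨b, hb⟩ p.1 p.2 hp)
    refine hun ⟨⟨⟨fun x => ⟨α, hα, (hA hα).1.1 x⟩, ?_⟩, ?_⟩, ?_⟩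
    · rintro x y ⟨b, hb, hxy⟩
      exact ⟨b, hb, (hA hb).1.2 x y hxy⟩
    · obtain ⟨ε, hε, hv⟩ := h.bdd a
      exact ⟨ε, hε, fun p hp => hv _ _ (hle p hp)⟩
    · intro huniv
      obtain ⟨x, y, hxy⟩ := h.unbounded a
      exact hxy (hle (x, y) (huniv ▸ Set.mem_univ _))

theorem covFlat_eq_covSharp_eq [Nonempty X] {θ : Cardinal.{u}}
    (hsharp : ∃ ε ∈ E.radii, ∀ δ ∈ E.radii, ⨆ x : X, ecov ε (eball x δ) < θ)
    (hflat : ∀ ν < θ, ∀ ε ∈ E.radii, ∃ δ ∈ E.radii, ∀ x : X, ν ≤ ecov ε (eball x δ)) :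
    E.covFlat = θ ∧ E.covSharp = θ := by
  have hle : ∀ ε δ (x : X), ecov ε (eball x δ) ≤ ⨆ x : X, ecov ε (eball x δ) := fun ε δ x =>
    le_ciSup (f := fun x => ecov ε (eball x δ)) bddAbove_of_small x
  let x := Classical.arbitrary X
  constructor
  · refine IsGreatest.csSup_eq ⟨hflat, fun κ hκ => ?_⟩
    obtain ⟨ε, hε, h⟩ := hsharp
    by_contra! hlt
    obtain ⟨δ, hδ, h'⟩ := hκ θ hlt ε hε
    exact absurd (h δ hδ) (not_lt.2 ((h' x).trans (hle ε δ x)))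
  · refine IsLeast.csInf_eq ⟨hsharp, fun κ hκ => ?_⟩
    obtain ⟨ε, hε, h⟩ := hκ
    by_contra! hlt
    obtain ⟨δ, hδ, h'⟩ := hflat κ hlt ε hε
    exact absurd (h δ hδ) (not_lt.2 ((h' x).trans (hle ε δ x)))

end Ballean

/-! ### The cardinal tail and sizes of intervals -/

section CardinalTail

variable {γ : Ordinal.{u}}

theorem exists_le_add_cardinalTail (hγ : γ ≠ 0) : ∃ β < γ, γ ≤ β + (cardinalTail γ).ord := by
  refine csInf_mem (s := {κ | ∃ β < γ, γ ≤ β + κ.ord}) ⟨Order.succ γ.card, 0, ?_, ?_⟩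
  · exact pos_iff_ne_zero.2 hγ
  · rw [zero_add]
    exact (Cardinal.lt_ord.2 (Order.lt_succ _)).le

theorem add_ord_lt_of_lt_cardinalTail {β : Ordinal.{u}} (hβ : β < γ) {μ : Cardinal.{u}}
    (hμ : μ < cardinalTail γ) : β + μ.ord < γ := by
  by_contra! h
  exact notMem_of_lt_csInf' hμ ⟨β, hβ, h⟩

theorem aleph0_le_cardinalTail (hγ : Order.IsSuccLimit γ) : ℵ₀ ≤ cardinalTail γ := by
  obtain ⟨β, hβ, h⟩ := exists_le_add_cardinalTail (Ordinal.isSuccLimit_iff.1 hγ).1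
  by_contra! hlt
  obtain ⟨n, hn⟩ := lt_aleph0.1 hlt
  rw [hn, ord_natCast] at h
  exact absurd h (not_le.2 (hγ.add_natCast_lt hβ n))

/-- When `γ ≤ β + ⌈γ⌉`, subtracting `β` embeds every interval above `β` into a proper initial
segment of the cardinal `⌈γ⌉`. -/
theorem exists_mk_Ioc_lt_cardinalTail (hγ : Order.IsSuccLimit γ) :
    ∃ a : γ.ToType, ∀ b, #(Set.Ioc a b) < cardinalTail γ := by
  obtain ⟨β, hβ, h⟩ := exists_le_add_cardinalTail (Ordinal.isSuccLimit_iff.1 hγ).1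
  refine ⟨Ordinal.ToType.mk ⟨β, hβ⟩, fun b => ?_⟩
  let η := Order.succ ((b.toOrd : Ordinal) - β)
  have hlim := isSuccLimit_ord (aleph0_le_cardinalTail hγ)
  have hη : η < (cardinalTail γ).ord :=
    hlim.succ_lt (Ordinal.sub_lt_of_lt_add ((show (b.toOrd : Ordinal) < γ from b.toOrd.2).trans_le h)
      hlim.bot_lt)
  rw [lt_ord, ← mk_toType] at hη
  refine lt_of_le_of_lt ?_ hη
  have hle : ∀ d : Set.Ioc (Ordinal.ToType.mk ⟨β, hβ⟩) b, β ≤ (d.1.toOrd : Ordinal) := by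
    rintro ⟨d, hd, -⟩
    have : (⟨β, hβ⟩ : Set.Iio γ) ≤ d.toOrd := by
      rw [← Ordinal.ToType.mk.le_iff_le]
      simpa using hd.le
    exact this
  refine mk_le_of_injective (f := fun d => Ordinal.ToType.mk
    ⟨(d.1.toOrd : Ordinal) - β, Set.mem_Iio.2 (Order.lt_succ_of_le ?_)⟩) ?_
  · have : d.1.toOrd ≤ b.toOrd := Ordinal.ToType.mk.symm.monotone d.2.2
    exact Ordinal.sub_le.2 ((show (d.1.toOrd : Ordinal) ≤ b.toOrd from this).trans
      (Ordinal.le_add_sub _ _))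
  · intro d d' hdd
    have h₁ := congrArg Subtype.val (Ordinal.ToType.mk.injective hdd)
    have h₂ : (d.1.toOrd : Ordinal) = d'.1.toOrd := by
      rw [← Ordinal.add_sub_cancel_of_le (hle d), ← Ordinal.add_sub_cancel_of_le (hle d')]
      exact congrArg (β + ·) h₁
    exact Subtype.ext (Ordinal.ToType.mk.symm.injective (Subtype.ext h₂))

theorem exists_le_mk_Ioc (hγ : Order.IsSuccLimit γ) (a : γ.ToType) {μ : Cardinal.{u}}
    (hμ : μ < cardinalTail γ) : ∃ b, μ ≤ #(Set.Ioc a b) := by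
  have hβ : Order.succ (a.toOrd : Ordinal) < γ := hγ.succ_lt a.toOrd.2
  have hlt := add_ord_lt_of_lt_cardinalTail hβ hμ
  refine ⟨Ordinal.ToType.mk ⟨_, hlt⟩, ?_⟩
  have hd : ∀ d : μ.ord.ToType, Order.succ (a.toOrd : Ordinal) + d.toOrd <
      Order.succ (a.toOrd : Ordinal) + μ.ord := fun d => by
    gcongr
    exact d.toOrd.2
  refine (mk_ord_toType μ).ge.trans ?_
  refine mk_le_of_injective (f := fun d => (⟨Ordinal.ToType.mk
    ⟨Order.succ (a.toOrd : Ordinal) + d.toOrd, Set.mem_Iio.2 ((hd d).trans hlt)⟩, ?_, ?_⟩ :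
      Set.Ioc a _)) ?_
  · have : a.toOrd < (⟨Order.succ (a.toOrd : Ordinal) + d.toOrd,
        Set.mem_Iio.2 ((hd d).trans hlt)⟩ : Set.Iio γ) := by
      change (a.toOrd : Ordinal) < Order.succ (a.toOrd : Ordinal) + d.toOrd
      exact (Order.lt_succ _).trans_le le_self_add
    simpa using Ordinal.ToType.mk.strictMono this
  · exact Ordinal.ToType.mk.monotone (hd d).le
  · intro d d' h
    have h := congrArg Subtype.val (Ordinal.ToType.mk.injective (congrArg Subtype.val h))
    exact Ordinal.ToType.mk.symm.injective (Subtype.ext (add_left_cancel h))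

end CardinalTail

theorem mk_finsupp_fin_two_lt {α : Type u} {θ : Cardinal.{u}} (hθ : ℵ₀ ≤ θ) (h : #α < θ) :
    #(α →₀ Fin 2) < θ := by
  obtain hα | hα := finite_or_infinite α
  · have : Finite (α →₀ Fin 2) := Finite.of_injective _ DFunLike.coe_injective
    exact (lt_aleph0_of_finite _).trans_le hθ
  · rw [mk_finsupp_lift_of_infinite]
    simpa using ⟨h, (natCast_lt_aleph0 (n := 2)).trans_le hθ⟩

/-! ### Invariants of balleans equivalent to the macro-cube -/

section Cube

variable {γ : Ordinal.{u}} {hγ : Order.IsSuccLimit γ} {X : Type u} {E : Ballean X}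

/-- The preimage under `f` of the equivalence relation of agreeing above `b`. -/
def agreeAbove (f : X → γ.ToType →₀ Fin 2) (b : γ.ToType) : Setoid X where
  r x y := ∀ α, b < α → f x α = f y α
  iseqv := ⟨fun _ _ _ => rfl, fun h α hα => (h α hα).symm,
    fun h h' α hα => (h α hα).trans (h' α hα)⟩

variable {f : X → γ.ToType →₀ Fin 2}

theorem exists_agree_of_isCoarseEquivalence (hf : E.IsCoarseEquivalence (cantorMacroCube γ hγ) f) :
    ∃ c, ∀ t : γ.ToType →₀ Fin 2, ∃ x, ∀ α, c < α → f x α = t α := by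
  obtain ⟨_, ⟨c, rfl⟩, h⟩ := hf.large
  exact ⟨c, h⟩

theorem isChain_agreeAbove (hf : E.IsCoarseEquivalence (cantorMacroCube γ hγ) f) :
    E.IsChain (agreeAbove f) where
  mono a b hab x y h α hα := h α (hab.trans_lt hα)
  bdd a := by
    obtain ⟨ε, hε, h⟩ := hf.proper _ ⟨a, rfl⟩
    exact ⟨ε, hε, fun x y hxy => h x y hxy⟩
  cofinal ε hε := by
    obtain ⟨_, ⟨a, rfl⟩, h⟩ := hf.coarse ε hε
    exact ⟨a, h⟩
  unbounded a := by
    obtain ⟨c, hc⟩ := exists_agree_of_isCoarseEquivalence hf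
    have : NoMaxOrder γ.ToType := Ordinal.isSuccPrelimit_type_lt_iff.1 <| by
      rw [Ordinal.type_toType]
      exact hγ.isSuccPrelimit
    obtain ⟨b, hb⟩ := exists_gt (max a c)
    obtain ⟨x, hx⟩ := hc 0
    obtain ⟨y, hy⟩ := hc (Finsupp.single b 1)
    refine ⟨x, y, fun h => ?_⟩
    have := h b ((le_max_left _ _).trans_lt hb)
    rw [hx b ((le_max_right _ _).trans_lt hb), hy b ((le_max_right _ _).trans_lt hb)] at this
    simp at this

theorem numClasses_agreeAbove_le (f : X → γ.ToType →₀ Fin 2) (a b : γ.ToType) (x : X) :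
    numClasses (agreeAbove f a) (agreeAbove f b) x ≤ #(Set.Ioc a b →₀ Fin 2) := by
  let φ : Quotient (agreeAbove f a) → (Set.Ioc a b →₀ Fin 2) :=
    Quotient.lift (fun y => (f y).subtypeDomain (· ∈ Set.Ioc a b)) fun y y' h => by
      ext d
      simp only [Finsupp.subtypeDomain_apply]
      rw [h d.1 d.2.1]
  refine mk_le_of_injective (f := fun q => φ q.1) ?_
  rintro ⟨_, y, hy, rfl⟩ ⟨_, y', hy', rfl⟩ h
  refine Subtype.ext (Quotient.sound fun α hα => ?_)
  by_cases hb : α ≤ b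
  · exact DFunLike.congr_fun h (⟨α, hα, hb⟩ : Set.Ioc a b)
  · exact (hy α (not_le.1 hb)).symm.trans (hy' α (not_le.1 hb))

/-- Flipping the single coordinate `d` of `f x`, for each `d` in `(a, b]`, gives pairwise different
classes. The image of `f` realises these points only above `c`, hence the assumption `c ≤ a`. -/
theorem le_numClasses_agreeAbove {c : γ.ToType}
    (hc : ∀ t : γ.ToType →₀ Fin 2, ∃ x, ∀ α, c < α → f x α = t α) {a : γ.ToType} (hca : c ≤ a)
    (b : γ.ToType) (x : X) :
    #(Set.Ioc a b) ≤ numClasses (agreeAbove f a) (agreeAbove f b) x := by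
  choose g hg using fun d : Set.Ioc a b => hc (f x + Finsupp.single d.1 1)
  refine mk_le_of_injective (f := fun d => (⟨Quotient.mk _ (g d), g d, ?_, rfl⟩ :
    Quotient.mk (agreeAbove f a) '' {y | agreeAbove f b x y})) ?_
  · intro α hα
    rw [hg d α ((hca.trans (d.2.1.le.trans d.2.2)).trans_lt hα), Finsupp.add_apply,
      Finsupp.single_eq_of_ne (d.2.2.trans_lt hα).ne', add_zero]
  · intro d d' h
    by_contra hne
    have h := Quotient.exact (congrArg Subtype.val h) d.1 d.2.1
    rw [hg d d.1 (hca.trans_lt d.2.1), hg d' d.1 (hca.trans_lt d.2.1), Finsupp.add_apply,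
      Finsupp.add_apply, Finsupp.single_eq_same,
      Finsupp.single_eq_of_ne fun h => hne (Subtype.ext h)] at h
    simp at h

theorem invariants_of_isCoarseEquivalence [Nonempty X]
    (hf : E.IsCoarseEquivalence (cantorMacroCube γ hγ) f) :
    E.IsCellular ∧ (E.add = E.cof ∧ E.cof = γ.cof) ∧
      (E.covFlat = E.covSharp ∧ E.covSharp = cardinalTail γ) := by
  have : Nonempty γ.ToType := Ordinal.nonempty_toType_iff.2 (Ordinal.isSuccLimit_iff.1 hγ).1
  have hch := isChain_agreeAbove hf
  have hθ := aleph0_le_cardinalTail hγ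
  obtain ⟨h₁, h₂⟩ : E.covFlat = cardinalTail γ ∧ E.covSharp = cardinalTail γ := by
    refine Ballean.covFlat_eq_covSharp_eq ?_ ?_
    · obtain ⟨a, ha⟩ := exists_mk_Ioc_lt_cardinalTail hγ
      obtain ⟨ε, hε, hεa⟩ := hch.bdd a
      refine ⟨ε, hε, fun δ hδ => ?_⟩
      obtain ⟨b, hb⟩ := hch.cofinal δ hδ
      refine (ciSup_le' fun x => ?_).trans_lt (mk_finsupp_fin_two_lt hθ (ha b))
      exact (ecov_le_numClasses hεa fun y hy => hb x y hy).trans (numClasses_agreeAbove_le f a b x)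
    · intro ν hν ε hε
      obtain ⟨c, hc⟩ := exists_agree_of_isCoarseEquivalence hf
      obtain ⟨a, ha⟩ := hch.cofinal ε hε
      obtain ⟨b, hb⟩ := exists_le_mk_Ioc hγ (max a c) hν
      obtain ⟨δ, hδ, hbδ⟩ := hch.bdd b
      refine ⟨δ, hδ, fun x => hb.trans ?_⟩
      refine (le_numClasses_agreeAbove hc (le_max_right a c) b x).trans ?_
      exact numClasses_le_ecov (E.refl _ hε) (fun x y h => hch.mono (le_max_left a c) (ha x y h))
        (fun y hy => hbδ x y hy)
  have hcof : Order.cof γ.ToType = γ.cof := Ordinal.cof_toType γ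
  exact ⟨hch.isCellular, ⟨hch.add_eq.trans hch.cof_eq.symm, hch.cof_eq.trans hcof⟩,
    h₁.trans h₂.symm, h₂⟩

end Cube

theorem mainTheorem4 (γ : Ordinal.{u}) (hγ : Order.IsSuccLimit γ) {X : Type u} (E : Ballean X) :
    E.CoarselyEquivalent (cantorMacroCube γ hγ) ↔
      (E.IsCellular ∧ (E.add = E.cof ∧ E.cof = γ.cof) ∧
        (E.covFlat = E.covSharp ∧ E.covSharp = cardinalTail γ)) := by
  constructor
  · intro h
    obtain ⟨f, hf⟩ := h.exists_map
    have : Nonempty X := by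
      obtain ⟨c, hc⟩ := exists_agree_of_isCoarseEquivalence hf
      exact ⟨(hc 0).choose⟩
    exact invariants_of_isCoarseEquivalence hf
  · rintro ⟨hcell, ⟨hadd, hcof⟩, hflat, hsharp⟩
    have hone : 1 < γ.cof := Ordinal.one_lt_cof_iff.2 hγ
    have : Nonempty X := Ballean.nonempty_of_one_lt_cof (hcof ▸ hone)
    have hE : E.IsTame γ.cof (cardinalTail γ) :=
      Ballean.isTame hcell (hadd.trans hcof) hcof (hflat.trans hsharp) hsharp
    -- The identity map shows that the cube has the required invariants itself.
    obtain ⟨hcell', ⟨hadd', hcof'⟩, hflat', hsharp'⟩ :=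
      invariants_of_isCoarseEquivalence (Ballean.IsCoarseEquivalence.id (cantorMacroCube γ hγ))
    exact hE.coarselyEquivalent
      (Ballean.isTame hcell' (hadd'.trans hcof') hcof' (hflat'.trans hsharp') hsharp')
      (zero_lt_one.trans hone).ne' (aleph0_le_cardinalTail hγ)
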